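/- Let $G$ be a group and let $n\ge 3$. Let $S_n(G)$ be the parametrized symmetric group, that is, the group generated by elements $s_i(a)$, $1\le i\le n-1$, $a\in G$, subject to the relations $$s_i(a)^2=1,\qquad s_i(a)\,s_{i+1}(b)\,s_i(c)=s_{i+1}(a^{-1}cb)\,s_i(a)\,s_{i+1}(b),\qquad s_i(a)\,s_j(b)=s_j(b)\,s_i(a)\ \text{ if } |i-j|\ge 2,$$ for all $a,b,c\in G$ and all indices for which the generators are defined. Let $G\wr S_n=G^n\rtimes S_n$, with multiplication $(g,s)(h,t)=(g\cdot{}^{s}h,\,st)$, where $({}^{s}h)_k=h_{s^{-1}(k)}$. For $x\in G$ let $x[k]\in G^n$ denote the vector whose $k$-th component is $x$ and whose other components are $1$. Then there is a well-defined group homomorphism $$\mu_n\colon S_n(G)\to G\wr S_n,\qquad \mu_n(s_i(a))=\bigl(a[i]\cdot a^{-1}[i+1],\ (i\ \,i+1)\bigr),$$ and the following hold. 1. $\mu_n$ is a crossed module: there is a right action $(m,x)\mapsto m^{x}$ of $G\wr S_n$ on $S_n(G)$ by group automorphisms such that $\mu_n(m^{x})=x^{-1}\mu_n(m)\,x$ and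 $m^{\mu_n(m')}=m'^{-1}m\,m'$ for all $m,m'\in S_n(G)$ and $x\in G\wr S_n$. Moreover, the action can be chosen so that $s_i(a)^{(h,1)}=s_i(h_i^{-1}a\,h_{i+1})$ for all $h\in G^n$, $a\in G$ and $1\le i\le n-1$. 2. The image of $\mu_n$ is normal in $G\wr S_n$, and the cokernel $(G\wr S_n)/\operatorname{Im}\mu_n$ is isomorphic to $H_1(G,\mathbb Z)$. 3. The kernel of $\mu_n$ is isomorphic to $H_2(G,\mathbb Z)$. Here $H_k(G,\mathbb Z)$ is the integral homology of the group $G$, with trivial action on $\mathbb Z$. -/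

import Mathlib

universe u

namespace ParamSymm

/-- The defining relators of the parametrized symmetric group. The generator `s_i(a)` is the
pair `(i, a)`; indices are numbered from `0`, so `i` ranges over `0, …, n - 2`. -/
inductive Rel (n : ℕ) (G : Type u) [Group G] : FreeGroup (Fin (n - 1) × G) → Prop
  /-- `s_i(a)² = 1`. -/
  | sq (i : Fin (n - 1)) (a : G) : Rel n G (FreeGroup.of (i, a) ^ 2)
  /-- `s_i(a) s_{i+1}(b) s_i(c) = s_{i+1}(a⁻¹cb) s_i(a) s_{i+1}(b)`. -/
  | braid (i j : Fin (n - 1)) (hij : (j : ℕ) = i + 1) (a b c : G) :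
      Rel n G (FreeGroup.of (i, a) * FreeGroup.of (j, b) * FreeGroup.of (i, c) *
        (FreeGroup.of (j, a⁻¹ * c * b) * FreeGroup.of (i, a) * FreeGroup.of (j, b))⁻¹)
  /-- `s_i(a) s_j(b) = s_j(b) s_i(a)` for `|i - j| ≥ 2`. -/
  | comm (i j : Fin (n - 1)) (hij : (i : ℕ) + 2 ≤ j ∨ (j : ℕ) + 2 ≤ i) (a b : G) :
      Rel n G (FreeGroup.of (i, a) * FreeGroup.of (j, b) *
        (FreeGroup.of (j, b) * FreeGroup.of (i, a))⁻¹)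

/-- The parametrized symmetric group `S_n(G)`. -/
abbrev SymG (n : ℕ) (G : Type u) [Group G] : Type u :=
  PresentedGroup {r : FreeGroup (Fin (n - 1) × G) | Rel n G r}

/-- The generator `s_i(a)` of `S_n(G)`. -/
def s {n : ℕ} {G : Type u} [Group G] (i : Fin (n - 1)) (a : G) : SymG n G :=
  PresentedGroup.of (i, a)

/-- The wreath product `G ≀ S_n = Gⁿ ⋊ S_n`, with multiplication
`(g, s) (h, t) = (g · ˢh, s t)` where `(ˢh)_k = h_{s⁻¹(k)}`. -/
abbrev Wreath (n : ℕ) (G : Type u) [Group G] : Type u :=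
  (Fin n → G) ⋊[mulAutArrow] Equiv.Perm (Fin n)

/-- The left one of the two points exchanged by the `i`-th simple transposition. -/
def lo {n : ℕ} (i : Fin (n - 1)) : Fin n := ⟨i, by omega⟩

/-- The right one of the two points exchanged by the `i`-th simple transposition. -/
def hi {n : ℕ} (i : Fin (n - 1)) : Fin n := ⟨i + 1, by omega⟩

/-- The image of `s_i(a)` in `G ≀ S_n`: the vector with `a` at place `i`, `a⁻¹` at place `i + 1`
and `1` elsewhere, together with the transposition `(i, i + 1)`. -/
def muGen {n : ℕ} {G : Type u} [Group G] (x : Fin (n - 1) × G) : Wreath n G :=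
  ⟨Pi.mulSingle (lo x.1) x.2 * Pi.mulSingle (hi x.1) x.2⁻¹, Equiv.swap (lo x.1) (hi x.1)⟩

theorem arrow_apply {n : ℕ} {G : Type u} [Group G] (σ : Equiv.Perm (Fin n)) (f : Fin n → G)
    (k : Fin n) : (mulAutArrow σ : MulAut (Fin n → G)) f k = f (σ⁻¹ k) := rfl

theorem muGen_rel {n : ℕ} {G : Type u} [Group G] (r : FreeGroup (Fin (n - 1) × G))
    (hr : r ∈ {r : FreeGroup (Fin (n - 1) × G) | Rel n G r}) :
    FreeGroup.lift (muGen (n := n) (G := G)) r = 1 := by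
  rcases hr with ⟨i, a⟩ | ⟨i, j, hij, a, b, c⟩ | ⟨i, j, hij, a, b⟩
  · have h1 : lo i ≠ hi i := by simp [lo, hi]
    rw [map_pow, FreeGroup.lift_apply_of, pow_two]
    ext k
    · simp only [muGen, SemidirectProduct.mul_left, SemidirectProduct.one_left, arrow_apply,
        Pi.mul_apply, Pi.one_apply, Pi.mulSingle_apply, Equiv.swap_inv,
        Equiv.swap_apply_def]
      generalize lo i = p at *
      generalize hi i = q at *
      split_ifs <;> simp_all
    · simp [muGen]
  · have h1 : lo i ≠ hi i := by simp [lo, hi]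
    have h2 : hi i ≠ hi j := by simp [hi]; omega
    have h3 : lo i ≠ hi j := by simp [lo, hi]; omega
    have h4 : lo j = hi i := by simp [lo, hi, hij]
    rw [map_mul, map_inv, mul_inv_eq_one]
    simp only [map_mul, FreeGroup.lift_apply_of]
    ext k
    · simp only [muGen, SemidirectProduct.mul_left, SemidirectProduct.mul_right,
        arrow_apply, mul_inv_rev, Equiv.Perm.mul_apply, h4,
        Pi.mul_apply, Pi.mulSingle_apply, Equiv.swap_inv,
        Equiv.swap_apply_def]
      generalize lo i = p at *
      generalize hi i = q at *
      generalize hi j = r at *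
      by_cases hp : k = p
      · subst hp; simp_all [eq_comm, mul_assoc]
      by_cases hq : k = q
      · subst hq; simp_all [eq_comm, mul_assoc]
      by_cases hr : k = r
      · subst hr; simp_all [eq_comm, mul_assoc]
      simp [*]
    · simp only [muGen, SemidirectProduct.mul_right, h4, Equiv.Perm.mul_apply]
      simp only [Equiv.swap_apply_def]
      generalize lo i = p at *
      generalize hi i = q at *
      generalize hi j = r at *
      by_cases hp : k = p
      · subst hp; simp_all [eq_comm, mul_assoc]
      by_cases hq : k = q
      · subst hq; simp_all [eq_comm, mul_assoc]
      by_cases hr : k = r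
      · subst hr; simp_all [eq_comm, mul_assoc]
      simp [*]
  · have h1 : lo i ≠ hi i := by simp [lo, hi]
    have h2 : lo j ≠ hi j := by simp [lo, hi]
    have h3 : lo i ≠ lo j := by simp [lo]; omega
    have h4 : lo i ≠ hi j := by simp [lo, hi]; omega
    have h5 : hi i ≠ lo j := by simp [lo, hi]; omega
    have h6 : hi i ≠ hi j := by simp [hi]; omega
    rw [map_mul, map_inv, mul_inv_eq_one]
    simp only [map_mul, FreeGroup.lift_apply_of]
    ext k
    · simp only [muGen, SemidirectProduct.mul_left, arrow_apply,
        Pi.mul_apply, Pi.mulSingle_apply, Equiv.swap_inv,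
        Equiv.swap_apply_def]
      generalize lo i = p at *
      generalize hi i = q at *
      generalize lo j = r at *
      generalize hi j = t at *
      by_cases hp : k = p
      · subst hp; simp_all [eq_comm, mul_assoc]
      by_cases hq : k = q
      · subst hq; simp_all [eq_comm, mul_assoc]
      by_cases hr : k = r
      · subst hr; simp_all [eq_comm, mul_assoc]
      by_cases ht : k = t
      · subst ht; simp_all [eq_comm, mul_assoc]
      simp [*]
    · simp only [muGen, SemidirectProduct.mul_right, Equiv.Perm.mul_apply]
      simp only [Equiv.swap_apply_def]
      generalize lo i = p at *
      generalize hi i = q at *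
      generalize lo j = r at *
      generalize hi j = t at *
      by_cases hp : k = p
      · subst hp; simp [*]
      by_cases hq : k = q
      · subst hq; simp_all [eq_comm, mul_assoc]
      by_cases hr : k = r
      · subst hr; simp_all [eq_comm, mul_assoc]
      by_cases ht : k = t
      · subst ht; simp_all [eq_comm, mul_assoc]
      simp [*]

/-- The homomorphism `μ_n : S_n(G) → G ≀ S_n`. -/
def mu (n : ℕ) (G : Type u) [Group G] : SymG n G →* Wreath n G :=
  PresentedGroup.toGroup (f := muGen) muGen_rel

/-- A homomorphism `μ : M → N` together with a right action of `N` on `M` by automorphisms,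
`m ^ n = act (op n) m`, is a crossed module. -/
structure IsCrossedModule {M N : Type*} [Group M] [Group N] (μ : M →* N)
    (act : Nᵐᵒᵖ →* MulAut M) : Prop where
  /-- `μ (m ^ n) = n⁻¹ μ(m) n`. -/
  equivariant : ∀ (m : M) (n : N), μ (act (MulOpposite.op n) m) = n⁻¹ * μ m * n
  /-- The Peiffer identity `m ^ μ(m') = m'⁻¹ m m'`. -/
  peiffer : ∀ m m' : M, act (MulOpposite.op (μ m')) m = m'⁻¹ * m * m'

/-- Integral group homology `H_m(G, ℤ)`, with trivial action on `ℤ`; `ℤ` is lifted to the universe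
of `G`. -/
noncomputable abbrev H (m : ℕ) (G : Type u) [Group G] : Type u :=
  groupHomology (Rep.trivial (ULift.{u} ℤ) G (ULift.{u} ℤ)) m

end ParamSymm

/-! Write x[k] for the vector with x at place k and 1 elsewhere.

Action. `Gⁿ` acts on S_n(G) by rescaling the generators, and S_n acts by conjugation through the
subgroup generated by the s_i(1), which the Coxeter normal form identifies with S_n. The two actions
fit together because s_i(a) s_i(b) s_i(a) = s_i(a b⁻¹ a) (`s_conj_self`), a consequence of the braid
relations with a neighbouring generator. Since s_i(a) is a rescaling of s_i(1), the Peiffer identity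
follows (`act_mu`).

Cokernel. Permutations lie in the image of μ_n, so all places become identified with the first one.
As [a, b][1] is the commutator of a[1] a⁻¹[2] and b[1] b⁻¹[3], what is left is the abelianization of
G.

Kernel. Let C = C₂/B₂ be the inhomogeneous 2-chains modulo boundaries, and E the central extension
of G by C with the tautological cocycle (`UnivExt`). The abelianization of E embeds in the 1-chains
by a map extending the boundary, so C ∩ [E, E] = Z₂/B₂ = H₂(G). Let Z be the group of vectors in Cⁿ
with product 1. Modulo Z, μ_n(s_i(e)) depends only on the image of e in G, which gives `embed` from
S_n(G) to (E ≀ S_n)/Z, lifting μ_n. The kernel of (E ≀ S_n)/Z → G ≀ S_n is C, and `embed` maps ker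
μ_n onto C ∩ [E, E].

The main point is that `embed` is injective. For this S_n(G) is embedded in a group T where each
x[1] has a lift ι x that acts on S_n(G) as x[1] does, with ι multiplicative up to the centre and
conjugates at different places commuting. By the universal property of E this yields a homomorphism
(E ≀ S_n)/Z → T whose composite with `embed` is the inclusion of S_n(G). The lifts are adjoined one
by one as semidirect products with ℤ, which is possible because the commutators [w, x[1]] lift
coherently to S_n(G) (`CommutatorPairing`, `commutatorPairing`). -/

namespace ParamSymm

/-! ### Normal form for the Coxeter relations of type A -/

section Coxeter

variable {Γ : Type*} [Group Γ]

/-- The subgroup generated by `t i` for `k ≤ i < N`. -/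
def tailSubgroup (t : ℕ → Γ) (N k : ℕ) : Subgroup Γ :=
  Subgroup.closure {g | ∃ i, k ≤ i ∧ i < N ∧ g = t i}

theorem mem_tailSubgroup (t : ℕ → Γ) {N k i : ℕ} (hk : k ≤ i) (hN : i < N) :
    t i ∈ tailSubgroup t N k :=
  Subgroup.subset_closure ⟨i, hk, hN, rfl⟩

/-- The descending product `t (k + l - 1) * ⋯ * t (k + 1) * t k`. -/
def descProd (t : ℕ → Γ) (k : ℕ) : ℕ → Γ
  | 0 => 1
  | l + 1 => t (k + l) * descProd t k l

theorem commute_descProd {t : ℕ → Γ} {N : ℕ}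
    (hcomm : ∀ i j, i + 2 ≤ j → j < N → t i * t j = t j * t i)
    (k : ℕ) {i : ℕ} (hN : i < N) : ∀ l, k + l < i → t i * descProd t k l = descProd t k l * t i
  | 0, _ => by simp [descProd]
  | l + 1, h => by
    rw [descProd, ← mul_assoc, ← hcomm (k + l) i (by omega) hN, mul_assoc, mul_assoc,
      commute_descProd hcomm k hN l (by omega)]

/-- The factors above t (i + 1) commute with t i, the braid relation at t (i + 1) * t i turns it
into t (i + 1), and this commutes with the factors below. -/
theorem mul_descProd {t : ℕ → Γ} {N : ℕ}
    (hbraid : ∀ i, i + 1 < N → t i * t (i + 1) * t i = t (i + 1) * t i * t (i + 1))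
    (hcomm : ∀ i j, i + 2 ≤ j → j < N → t i * t j = t j * t i)
    (k : ℕ) {i : ℕ} (hk : k ≤ i) : ∀ l, i + 1 < k + l → k + l ≤ N →
      t i * descProd t k l = descProd t k l * t (i + 1)
  | 0, h, _ => by omega
  | l + 1, h, hl => by
    rcases Nat.lt_or_ge (i + 1) (k + l) with h' | h'
    · rw [descProd, ← mul_assoc, hcomm i (k + l) (by omega) (by omega), mul_assoc, mul_assoc,
        mul_descProd hbraid hcomm k hk l h' (by omega)]
    · obtain ⟨m, rfl⟩ : ∃ m, l = m + 1 := ⟨l - 1, by omega⟩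
      obtain rfl : i = k + m := by omega
      rw [descProd, descProd, show k + (m + 1) = k + m + 1 by omega]
      simp only [← mul_assoc]
      rw [hbraid _ (by omega), mul_assoc, mul_assoc, mul_assoc _ _ (t (k + m + 1)), mul_assoc,
        commute_descProd hcomm k (by omega) m (by omega)]

/-- The descending products represent all left cosets of the next tail subgroup: left multiplication
by t i either passes through the product, cancels its top factor (i = k + l - 1) or lengthens it (i
= k + l). -/
theorem exists_eq_descProd_mul {t : ℕ → Γ} {N : ℕ} (hsq : ∀ i, i < N → t i * t i = 1)
    (hbraid : ∀ i, i + 1 < N → t i * t (i + 1) * t i = t (i + 1) * t i * t (i + 1))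
    (hcomm : ∀ i j, i + 2 ≤ j → j < N → t i * t j = t j * t i)
    {k : ℕ} (hk : k ≤ N) {w : Γ} (hw : w ∈ tailSubgroup t N k) :
    ∃ l, k + l ≤ N ∧ ∃ h ∈ tailSubgroup t N (k + 1), w = descProd t k l * h := by
  have key : ∀ i, k ≤ i → i < N → ∀ y : Γ,
      (∃ l, k + l ≤ N ∧ ∃ h ∈ tailSubgroup t N (k + 1), y = descProd t k l * h) →
      ∃ l, k + l ≤ N ∧ ∃ h ∈ tailSubgroup t N (k + 1), t i * y = descProd t k l * h := by
    rintro i hi hN y ⟨l, hl, h, hh, rfl⟩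
    rcases lt_trichotomy i (k + l) with h1 | h1 | h1
    · rcases Nat.lt_or_ge (i + 1) (k + l) with h2 | h2
      · refine ⟨l, hl, t (i + 1) * h,
          mul_mem (mem_tailSubgroup t (by omega) (by omega)) hh, ?_⟩
        rw [← mul_assoc, mul_descProd hbraid hcomm k hi l h2 hl, mul_assoc]
      · obtain ⟨m, rfl⟩ : ∃ m, l = m + 1 := ⟨l - 1, by omega⟩
        obtain rfl : i = k + m := by omega
        refine ⟨m, by omega, h, hh, ?_⟩
        rw [descProd, ← mul_assoc, ← mul_assoc, hsq _ hN, one_mul]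
    · exact ⟨l + 1, by omega, h, hh, by rw [descProd, h1, mul_assoc]⟩
    · refine ⟨l, hl, t i * h, mul_mem (mem_tailSubgroup t (by omega) hN) hh, ?_⟩
      rw [← mul_assoc, commute_descProd hcomm k hN l h1, mul_assoc]
  refine Subgroup.closure_induction_left (p := fun w _ => ∃ l, k + l ≤ N ∧
    ∃ h ∈ tailSubgroup t N (k + 1), w = descProd t k l * h) ?_ ?_ ?_ hw
  · exact ⟨0, hk, 1, one_mem _, by simp [descProd]⟩
  · rintro _ ⟨i, hi, hN, rfl⟩ y _ hy
    exact key i hi hN y hy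
  · rintro _ ⟨i, hi, hN, rfl⟩ y _ hy
    rw [inv_eq_of_mul_eq_one_left (hsq i hN)]
    exact key i hi hN y hy

end Coxeter

variable {n : ℕ} {G : Type u} [Group G]

/-! ### The copy of S_n inside S_n(G) -/

theorem s_sq (i : Fin (n - 1)) (a : G) : s i a * s i a = 1 := by
  have h : Rel n G _ := Rel.sq i a
  have := PresentedGroup.one_of_mem (rels := {r | Rel n G r}) h
  rwa [map_pow, pow_two] at this

theorem s_inv (i : Fin (n - 1)) (a : G) : (s i a)⁻¹ = s i a :=
  inv_eq_of_mul_eq_one_left (s_sq i a)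

theorem s_mul_s_mul (i : Fin (n - 1)) (a : G) (x : SymG n G) : s i a * (s i a * x) = x := by
  rw [← mul_assoc, s_sq, one_mul]

theorem s_braid (i j : Fin (n - 1)) (hij : (j : ℕ) = i + 1) (a b c : G) :
    s i a * s j b * s i c = s j (a⁻¹ * c * b) * s i a * s j b := by
  have h : Rel n G _ := Rel.braid i j hij a b c
  exact PresentedGroup.mk_eq_mk_of_mul_inv_mem (rels := {r | Rel n G r}) h

theorem s_comm (i j : Fin (n - 1)) (hij : (i : ℕ) + 2 ≤ j ∨ (j : ℕ) + 2 ≤ i) (a b : G) :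
    s i a * s j b = s j b * s i a := by
  have h : Rel n G _ := Rel.comm i j hij a b
  exact PresentedGroup.mk_eq_mk_of_mul_inv_mem (rels := {r | Rel n G r}) h

theorem mu_s (i : Fin (n - 1)) (a : G) :
    mu n G (s i a) = ⟨Pi.mulSingle (lo i) a * Pi.mulSingle (hi i) a⁻¹,
      Equiv.swap (lo i) (hi i)⟩ :=
  PresentedGroup.toGroup.of muGen_rel

theorem symG_induction {C : SymG n G → Prop} (one : C 1)
    (mul : ∀ i a m, C m → C (s i a * m)) (m : SymG n G) : C m := by
  have h := PresentedGroup.closure_range_of {r | Rel n G r}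
  have hm : m ∈ Subgroup.closure (Set.range (PresentedGroup.of (rels := {r | Rel n G r}))) :=
    h ▸ Subgroup.mem_top m
  refine Subgroup.closure_induction_left (p := fun m _ => C m) one ?_ ?_ hm
  · rintro _ ⟨⟨i, a⟩, rfl⟩ y _ hy
    exact mul i a y hy
  · rintro _ ⟨⟨i, a⟩, rfl⟩ y _ hy
    have := s_inv i a
    rw [s] at this
    rw [this]
    exact mul i a y hy

/-- The simple reflections `s_i(1)`, extended by `1` to all indices. -/
def refl (n : ℕ) (G : Type u) [Group G] (i : ℕ) : SymG n G :=
  if h : i < n - 1 then s ⟨i, h⟩ 1 else 1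

theorem refl_of_lt {i : ℕ} (h : i < n - 1) : refl n G i = s ⟨i, h⟩ 1 := dif_pos h

theorem refl_coe (i : Fin (n - 1)) : refl n G i = s i 1 := dif_pos i.2

/-- The projection of `S_n(G)` to `S_n`. -/
def toPerm (n : ℕ) (G : Type u) [Group G] : SymG n G →* Equiv.Perm (Fin n) :=
  SemidirectProduct.rightHom.comp (mu n G)

theorem toPerm_s (i : Fin (n - 1)) (a : G) :
    toPerm n G (s i a) = Equiv.swap (lo i) (hi i) := by
  simp [toPerm, mu_s]

theorem toPerm_apply_of_mem_tailSubgroup {k : ℕ} (hk : k < n) {w : SymG n G}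
    (hw : w ∈ tailSubgroup (refl n G) (n - 1) (k + 1)) : toPerm n G w ⟨k, hk⟩ = ⟨k, hk⟩ := by
  refine Subgroup.closure_induction (p := fun w _ => toPerm n G w ⟨k, hk⟩ = ⟨k, hk⟩)
    ?_ (by simp) ?_ ?_ hw
  · rintro _ ⟨i, hi, hN, rfl⟩
    rw [refl_of_lt hN, toPerm_s]
    apply Equiv.swap_apply_of_ne_of_ne <;> simp [lo, ParamSymm.hi] <;> omega
  · intro x y _ _ hx hy
    simp [hx, hy]
  · intro x _ hx
    rw [map_inv, Equiv.Perm.inv_eq_iff_eq, hx]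

theorem toPerm_descProd {k : ℕ} (hk : k < n) : ∀ (l : ℕ) (hl : k + l ≤ n - 1),
    toPerm n G (descProd (refl n G) k l) ⟨k, hk⟩ = ⟨k + l, by omega⟩
  | 0, _ => by simp [descProd]
  | l + 1, hl => by
    rw [descProd, map_mul, Equiv.Perm.mul_apply, toPerm_descProd hk l (by omega),
      refl_of_lt (by omega), toPerm_s]
    exact Equiv.swap_apply_left _ _

/-- The coset representative of length l moves the point k to k + l, so an element fixing k has l =
0. -/
theorem mem_tailSubgroup_succ {k : ℕ} (hk : k < n) {w : SymG n G}
    (hw : w ∈ tailSubgroup (refl n G) (n - 1) k) (h : toPerm n G w ⟨k, hk⟩ = ⟨k, hk⟩) :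
    w ∈ tailSubgroup (refl n G) (n - 1) (k + 1) := by
  obtain ⟨l, hl, v, hv, rfl⟩ := exists_eq_descProd_mul (t := refl n G) (N := n - 1)
    (fun i hi => by rw [refl_of_lt hi, s_sq])
    (fun i hi => by
      rw [refl_of_lt hi, refl_of_lt (show i < n - 1 by omega)]
      simpa using s_braid (G := G) ⟨i, by omega⟩ ⟨i + 1, hi⟩ rfl 1 1 1)
    (fun i j hij hj => by
      rw [refl_of_lt hj, refl_of_lt (show i < n - 1 by omega)]
      exact s_comm _ _ (Or.inl hij) _ _)
    (by omega) hw
  rw [map_mul, Equiv.Perm.mul_apply, toPerm_apply_of_mem_tailSubgroup hk hv,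
    toPerm_descProd hk l hl, Fin.mk.injEq] at h
  obtain rfl : l = 0 := by omega
  simpa [descProd] using hv

/-- A trivial permutation fixes 0, 1, …, n - 1 in turn, so w descends through all the tail subgroups
to one without generators. -/
theorem eq_one_of_mem_tailSubgroup {w : SymG n G}
    (hw : w ∈ tailSubgroup (refl n G) (n - 1) 0) (h : toPerm n G w = 1) : w = 1 := by
  have key : ∀ k, k ≤ n → w ∈ tailSubgroup (refl n G) (n - 1) k := by
    intro k
    induction k with
    | zero => exact fun _ => hw
    | succ k ih => exact fun hk => mem_tailSubgroup_succ hk (ih (by omega)) (by simp [h])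
  have := key n le_rfl
  rw [tailSubgroup] at this
  have he : {g | ∃ i, n ≤ i ∧ i < n - 1 ∧ g = refl n G i} = ∅ := by
    ext g
    simp only [Set.mem_ofPred_eq, Set.mem_empty_iff_false, iff_false]
    rintro ⟨i, h1, h2, -⟩
    omega
  rwa [he, Subgroup.closure_empty, Subgroup.mem_bot] at this

theorem perm_induction {C : Equiv.Perm (Fin n) → Prop} (one : C 1)
    (mul : ∀ (i : Fin (n - 1)) σ, C σ → C (Equiv.swap (lo i) (hi i) * σ))
    (σ : Equiv.Perm (Fin n)) : C σ := by
  rcases n with _ | n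
  · rwa [Subsingleton.elim σ 1]
  have hσ : σ ∈ Submonoid.closure
      (Set.range fun i : Fin n ↦ Equiv.swap i.castSucc i.succ) := by
    rw [Equiv.Perm.mclosure_swap_castSucc_succ]; trivial
  refine Submonoid.closure_induction_left (motive := fun σ _ => C σ) one ?_ hσ
  rintro _ ⟨i, rfl⟩ y _ hy
  exact mul i y hy

theorem exists_mem_tailSubgroup (σ : Equiv.Perm (Fin n)) :
    ∃ w ∈ tailSubgroup (refl n G) (n - 1) 0, toPerm n G w = σ := by
  induction σ using perm_induction with
  | one => exact ⟨1, one_mem _, map_one _⟩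
  | mul i σ ih =>
    obtain ⟨w, hw, rfl⟩ := ih
    refine ⟨refl n G i * w, mul_mem (mem_tailSubgroup _ (Nat.zero_le _) i.2) hw, ?_⟩
    rw [map_mul, refl_coe, toPerm_s]

/-- The subgroup generated by the `s_i(1)` is the symmetric group. -/
noncomputable def tailEquivPerm (n : ℕ) (G : Type u) [Group G] :
    tailSubgroup (refl n G) (n - 1) 0 ≃* Equiv.Perm (Fin n) :=
  MulEquiv.ofBijective ((toPerm n G).comp (tailSubgroup (refl n G) (n - 1) 0).subtype)
    ⟨(injective_iff_map_eq_one _).2 fun w hw => Subtype.ext (eq_one_of_mem_tailSubgroup w.2 hw),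
      fun σ => by
        obtain ⟨w, hw, h⟩ := exists_mem_tailSubgroup (G := G) σ
        exact ⟨⟨w, hw⟩, h⟩⟩

/-- The embedding of `S_n` into `S_n(G)` sending `(i, i + 1)` to `s_i(1)`. -/
noncomputable def hat (n : ℕ) (G : Type u) [Group G] : Equiv.Perm (Fin n) →* SymG n G :=
  (tailSubgroup (refl n G) (n - 1) 0).subtype.comp (tailEquivPerm n G).symm.toMonoidHom

theorem hat_mem (σ : Equiv.Perm (Fin n)) :
    hat n G σ ∈ tailSubgroup (refl n G) (n - 1) 0 :=
  Subtype.property _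

theorem toPerm_hat (σ : Equiv.Perm (Fin n)) : toPerm n G (hat n G σ) = σ :=
  (tailEquivPerm n G).apply_symm_apply σ

theorem hat_swap (i : Fin (n - 1)) : hat n G (Equiv.swap (lo i) (hi i)) = s i 1 := by
  rw [← mul_inv_eq_one]
  apply eq_one_of_mem_tailSubgroup
  · refine mul_mem (hat_mem _) (inv_mem ?_)
    rw [← refl_coe]
    exact mem_tailSubgroup _ (Nat.zero_le _) i.2
  · rw [map_mul, toPerm_hat, map_inv, toPerm_s, mul_inv_cancel]

theorem mu_hat (σ : Equiv.Perm (Fin n)) : mu n G (hat n G σ) = SemidirectProduct.inr σ := by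
  induction σ using perm_induction with
  | one => simp
  | mul i σ ih =>
    rw [map_mul, map_mul, ih, hat_swap, mu_s, map_mul]
    congr 1
    ext <;> simp

end ParamSymm

/-! ### The action of G ≀ S_n and the crossed module identities -/

namespace ParamSymm

variable {n : ℕ} {G : Type u} [Group G]

/-- The braid relation with third parameter c = a b d⁻¹. The point is that d is free: later
computations choose it to absorb unwanted entries. -/
theorem s_conj_succ (i j : Fin (n - 1)) (hij : (j : ℕ) = i + 1) (a b d : G) :
    s i a * s j b * s i a = s j d * s i (a * b * d⁻¹) * s j d := by
  have h := s_braid i j hij a d (a * b * d⁻¹)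
  rw [show a⁻¹ * (a * b * d⁻¹) * d = b by group] at h
  have h2 : s j b = s i a * s j d * s i (a * b * d⁻¹) * s j d * s i a := by
    rw [h]
    simp only [mul_assoc, s_sq, mul_one]
  rw [h2]
  simp only [mul_assoc, s_mul_s_mul, s_sq, mul_one]

/-- Inserting s_j(1)² for a neighbour j writes the left side as x y x with x = s_i(a) s_j(1) s_i(a).
Here y collapses to a single s_j(d), and x = s_j(d) s_i(a b⁻¹ a) s_j(d) for i < j (with another
conjugating pair for j < i), so the braid relation finishes. -/
theorem s_conj_self (hn : 3 ≤ n) (i : Fin (n - 1)) (a b : G) :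
    s i a * s i b * s i a = s i (a * b⁻¹ * a) := by
  by_cases hi : (i : ℕ) + 1 < n - 1
  · have hij : ((⟨i + 1, hi⟩ : Fin (n - 1)) : ℕ) = i + 1 := rfl
    generalize (⟨i + 1, hi⟩ : Fin (n - 1)) = j at hij
    have h1 : s i a * s i b * s i a = (s i a * s j 1 * s i a) *
        (s i a * (s j 1 * s i b * s j 1) * s i a) * (s i a * s j 1 * s i a) := by
      simp only [mul_assoc, s_mul_s_mul]
    have h2 : s j 1 * s i b * s j 1 = s i a * s j (a⁻¹ * b) * s i a := by
      rw [s_conj_succ i j hij a (a⁻¹ * b) 1]; congr 3; group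
    have h3 : s i a * (s j 1 * s i b * s j 1) * s i a = s j (a⁻¹ * b) := by
      rw [h2]; simp only [mul_assoc, s_mul_s_mul, s_sq, mul_one]
    have h4 := s_conj_succ i j hij a 1 (a⁻¹ * b)
    rw [show a * 1 * (a⁻¹ * b)⁻¹ = a * b⁻¹ * a by group] at h4
    have h5 := s_conj_succ i j hij (a * b⁻¹ * a) (a⁻¹ * b) (a⁻¹ * b)
    rw [mul_inv_cancel_right] at h5
    have h6 := congrArg (s j (a⁻¹ * b) * · * s j (a⁻¹ * b)) h5
    simp only [mul_assoc, s_mul_s_mul, s_sq, mul_one] at h6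
    rw [h1, h3, h4]
    simp only [mul_assoc, s_mul_s_mul]
    exact h6
  -- The last generator has no right neighbour; since n ≥ 3 it has a left one, so the subtraction
  -- does not truncate.
  · have hij : (i : ℕ) = (⟨i - 1, by omega⟩ : Fin (n - 1)) + 1 := by
      have := i.2
      simp only
      omega
    generalize (⟨i - 1, by omega⟩ : Fin (n - 1)) = j at hij
    have h1 : s i a * s i b * s i a = (s i a * s j 1 * s i a) *
        (s i a * (s j 1 * s i b * s j 1) * s i a) * (s i a * s j 1 * s i a) := by
      simp only [mul_assoc, s_mul_s_mul]
    have h3 : s i a * (s j 1 * s i b * s j 1) * s i a = s j (b * a⁻¹) := by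
      rw [s_conj_succ j i hij 1 b a, one_mul]
      simp only [mul_assoc, s_mul_s_mul, s_sq, mul_one]
    have h4 := s_conj_succ j i hij (b * a⁻¹) (a * b⁻¹ * a) a
    rw [show b * a⁻¹ * (a * b⁻¹ * a) * a⁻¹ = 1 by group] at h4
    have h5 := s_conj_succ j i hij (b * a⁻¹) (a * b⁻¹ * a) (a * b⁻¹ * a)
    rw [mul_inv_cancel_right] at h5
    have h6 := congrArg (s j (b * a⁻¹) * · * s j (b * a⁻¹)) h5.symm
    simp only [mul_assoc, s_mul_s_mul, s_sq, mul_one] at h6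
    rw [h1, h3, ← h4]
    simp only [mul_assoc, s_mul_s_mul]
    exact h6

/-- In the braid relation the entries of g cancel inside a⁻¹ c b, leaving exactly the factors that
rescale s_{i+1}. -/
theorem diagGen_rel (g : Fin n → G) (r : FreeGroup (Fin (n - 1) × G))
    (hr : r ∈ {r : FreeGroup (Fin (n - 1) × G) | Rel n G r}) :
    FreeGroup.lift (fun x : Fin (n - 1) × G => s x.1 (g (lo x.1) * x.2 * (g (hi x.1))⁻¹)) r
      = 1 := by
  rcases hr with ⟨i, a⟩ | ⟨i, j, hij, a, b, c⟩ | ⟨i, j, hij, a, b⟩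
  · rw [map_pow, FreeGroup.lift_apply_of, pow_two, s_sq]
  · have h4 : lo j = hi i := by simp [lo, hi, hij]
    rw [map_mul, map_inv, mul_inv_eq_one]
    simp only [map_mul, FreeGroup.lift_apply_of, h4]
    rw [s_braid i j hij]
    congr 3
    group
  · rw [map_mul, map_inv, mul_inv_eq_one]
    simp only [map_mul, FreeGroup.lift_apply_of]
    exact s_comm _ _ hij _ _

/-- The endomorphism `s_i(a) ↦ s_i(g_i a g_{i+1}⁻¹)` of `S_n(G)`. -/
def diagHom (g : Fin n → G) : SymG n G →* SymG n G :=
  PresentedGroup.toGroup (diagGen_rel g)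

theorem diagHom_s (g : Fin n → G) (i : Fin (n - 1)) (a : G) :
    diagHom g (s i a) = s i (g (lo i) * a * (g (hi i))⁻¹) :=
  PresentedGroup.toGroup.of (diagGen_rel g)

theorem symG_hom_ext {K : Type*} [Group K] {f f' : SymG n G →* K}
    (h : ∀ i a, f (s i a) = f' (s i a)) : f = f' :=
  PresentedGroup.ext fun x => h x.1 x.2

theorem diagHom_one : diagHom (1 : Fin n → G) = MonoidHom.id _ :=
  symG_hom_ext fun i a => by simp [diagHom_s]

theorem diagHom_mul (g h : Fin n → G) : diagHom (g * h) = (diagHom g).comp (diagHom h) :=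
  symG_hom_ext fun i a => by simp [diagHom_s, mul_assoc]

/-- The left action of `Gⁿ` on `S_n(G)`. -/
def diagAct (n : ℕ) (G : Type u) [Group G] : (Fin n → G) →* MulAut (SymG n G) where
  toFun g :=
    { diagHom g with
      invFun := diagHom g⁻¹
      left_inv := fun m => by
        change ((diagHom g⁻¹).comp (diagHom g)) m = m
        rw [← diagHom_mul, inv_mul_cancel, diagHom_one]; rfl
      right_inv := fun m => by
        change ((diagHom g).comp (diagHom g⁻¹)) m = m
        rw [← diagHom_mul, mul_inv_cancel, diagHom_one]; rfl }
  map_one' := by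
    ext m
    exact DFunLike.congr_fun diagHom_one m
  map_mul' g h := by
    ext m
    exact DFunLike.congr_fun (diagHom_mul g h) m

theorem diagAct_s (g : Fin n → G) (i : Fin (n - 1)) (a : G) :
    diagAct n G g (s i a) = s i (g (lo i) * a * (g (hi i))⁻¹) :=
  diagHom_s g i a

theorem conj_s_diagAct (hn : 3 ≤ n) (i : Fin (n - 1)) (g : Fin n → G) (m : SymG n G) :
    s i 1 * diagAct n G g m * (s i 1)⁻¹ =
      diagAct n G (mulAutArrow (Equiv.swap (lo i) (hi i)) g) (s i 1 * m * (s i 1)⁻¹) := by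
  set g' : Fin n → G := mulAutArrow (Equiv.swap (lo i) (hi i)) g with hg'
  have hlo : g' (lo i) = g (hi i) := by
    rw [hg', arrow_apply, Equiv.swap_inv, Equiv.swap_apply_left]
  have hhi : g' (hi i) = g (lo i) := by
    rw [hg', arrow_apply, Equiv.swap_inv, Equiv.swap_apply_right]
  have hne : ∀ k, k ≠ lo i → k ≠ hi i → g' k = g k := fun k h1 h2 => by
    rw [hg', arrow_apply, Equiv.swap_inv, Equiv.swap_apply_of_ne_of_ne h1 h2]
  suffices h : ((MulAut.conj (s i 1)).toMonoidHom.comp (diagAct n G g).toMonoidHom) =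
      (diagAct n G g').toMonoidHom.comp (MulAut.conj (s i 1)).toMonoidHom by
    exact DFunLike.congr_fun h m
  apply symG_hom_ext
  intro j a
  change s i 1 * diagAct n G g (s j a) * (s i 1)⁻¹ =
    diagAct n G g' (s i 1 * s j a * (s i 1)⁻¹)
  rw [s_inv, diagAct_s]
  have hlh : (lo j : ℕ) = j := rfl
  have hhh : (hi j : ℕ) = j + 1 := rfl
  have hli : (lo i : ℕ) = i := rfl
  have hhi' : (hi i : ℕ) = i + 1 := rfl
  by_cases h0 : i = j
  · subst h0
    rw [s_conj_self hn, s_conj_self hn, diagAct_s, hlo, hhi]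
    congr 1
    group
  by_cases h1 : (j : ℕ) = i + 1
  · have e1 : lo j = hi i := Fin.ext (by omega)
    have e2 : g' (hi j) = g (hi j) := hne _ (by simp [Fin.ext_iff]; omega)
      (by simp [Fin.ext_iff]; omega)
    -- The free parameter is set to the rescaled value of 1, so that the outer factors on both sides
    -- agree.
    rw [s_conj_succ i j h1 1 a 1, map_mul, map_mul, diagAct_s, diagAct_s,
      s_conj_succ i j h1 1 _ (g' (lo j) * 1 * (g' (hi j))⁻¹), e1, hlo, hhi, e2]
    congr 3
    group
  by_cases h2 : (i : ℕ) = j + 1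
  · have e1 : hi j = lo i := Fin.ext (by omega)
    have e2 : g' (lo j) = g (lo j) := hne _ (by simp [Fin.ext_iff]; omega)
      (by simp [Fin.ext_iff]; omega)
    have h3 : s i 1 * s j a * s i 1 = s j 1 * s i a * s j 1 := by
      rw [s_conj_succ j i h2 1 a 1]; simp
    rw [h3, map_mul, map_mul, diagAct_s, diagAct_s,
      s_conj_succ j i h2 _ _ 1, e1, hlo, hhi, e2]
    congr 3
    group
  · have hc : (i : ℕ) + 2 ≤ j ∨ (j : ℕ) + 2 ≤ i := by
      have : (i : ℕ) ≠ j := fun h => h0 (Fin.ext h)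
      omega
    have h4 : ∀ b : G, s i 1 * s j b * s i 1 = s j b := fun b => by
      rw [s_comm i j hc, mul_assoc, s_sq, mul_one]
    rw [h4, h4, diagAct_s, hne, hne] <;> simp [Fin.ext_iff] <;> omega

theorem conj_hat_diagAct (hn : 3 ≤ n) (σ : Equiv.Perm (Fin n)) :
    ∀ (g : Fin n → G) (m : SymG n G), hat n G σ * diagAct n G g m * (hat n G σ)⁻¹ =
      diagAct n G (mulAutArrow σ g) (hat n G σ * m * (hat n G σ)⁻¹) := by
  induction σ using perm_induction with
  | one => intro g m; simp
  | mul i σ ih =>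
    intro g m
    have h := conj_s_diagAct hn i (mulAutArrow σ g) (hat n G σ * m * (hat n G σ)⁻¹)
    rw [← ih g m] at h
    rw [map_mul (hat n G), hat_swap, map_mul mulAutArrow, MulAut.mul_apply]
    simp only [mul_inv_rev, mul_assoc] at h ⊢
    exact h

/-- The left action of `G ≀ S_n` on `S_n(G)`. -/
noncomputable def act (hn : 3 ≤ n) (G : Type u) [Group G] : Wreath n G →* MulAut (SymG n G) :=
  SemidirectProduct.lift (diagAct n G) (MulAut.conj.comp (hat n G)) fun σ => by
    ext g m
    have h := conj_hat_diagAct hn σ g ((hat n G σ)⁻¹ * m * hat n G σ)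
    simp only [← mul_assoc, mul_inv_cancel_right, mul_inv_cancel, one_mul] at h
    simpa [mul_assoc] using h.symm

theorem act_inl (hn : 3 ≤ n) (g : Fin n → G) (m : SymG n G) :
    act hn G (SemidirectProduct.inl g) m = diagAct n G g m := by
  simp [act]

theorem act_inr (hn : 3 ≤ n) (σ : Equiv.Perm (Fin n)) (m : SymG n G) :
    act hn G (SemidirectProduct.inr σ) m = hat n G σ * m * (hat n G σ)⁻¹ := by
  simp [act]

theorem mulSingle_mul_swap (i : Fin (n - 1)) (a : G) :
    mu n G (s i a) = SemidirectProduct.inl (Pi.mulSingle (lo i) a) * mu n G (s i 1) *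
      (SemidirectProduct.inl (Pi.mulSingle (lo i) a))⁻¹ := by
  have h1 : lo i ≠ hi i := by simp [lo, hi]
  rw [mu_s, mu_s, ← map_inv]
  ext k
  · simp only [SemidirectProduct.mul_left, SemidirectProduct.left_inl,
      SemidirectProduct.right_inl, SemidirectProduct.mul_right, map_one,
      Pi.mul_apply, arrow_apply, one_mul, inv_one, mul_one, Pi.mulSingle_one, Pi.inv_apply,
      Equiv.swap_inv, Equiv.swap_apply_def, Pi.mulSingle_apply]
    generalize lo i = p at *
    generalize hi i = q at *
    split_ifs <;> simp_all [eq_comm]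
  · simp

/-- For s_i(1) this is the definition of the action. Both s_i(a) and its image under `mu` arise from
those of s_i(1) by acting, respectively conjugating, with a at place i, and inner automorphisms
transform accordingly. -/
theorem act_mu (hn : 3 ≤ n) (m' m : SymG n G) :
    act hn G (mu n G m') m = m' * m * m'⁻¹ := by
  induction m' using symG_induction generalizing m with
  | one => simp
  | mul i a m' ih =>
    have h1 : ∀ m, act hn G (mu n G (s i 1)) m = s i 1 * m * (s i 1)⁻¹ := fun m => by
      rw [← hat_swap, mu_hat, act_inr]
    have h2 : s i a = act hn G (SemidirectProduct.inl (Pi.mulSingle (lo i) a)) (s i 1) := by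
      have h1 : hi i ≠ lo i := by simp [lo, hi]
      rw [act_inl, diagAct_s]
      simp [Pi.mulSingle_eq_of_ne h1]
    have h3 : ∀ m, act hn G (mu n G (s i a)) m = s i a * m * (s i a)⁻¹ := fun m => by
      rw [mulSingle_mul_swap, map_mul, map_mul, MulAut.mul_apply, MulAut.mul_apply, h1, map_mul,
        map_mul, map_inv, map_inv, MulAut.apply_inv_self, ← h2]
    rw [map_mul, map_mul, MulAut.mul_apply, ih, h3]
    simp only [mul_inv_rev, mul_assoc]

theorem mu_diagAct (g : Fin n → G) (m : SymG n G) :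
    mu n G (diagAct n G g m) =
      SemidirectProduct.inl g * mu n G m * (SemidirectProduct.inl g)⁻¹ := by
  suffices h : (mu n G).comp (diagAct n G g).toMonoidHom =
      (MulAut.conj (SemidirectProduct.inl g)).toMonoidHom.comp (mu n G) from
    DFunLike.congr_fun h m
  apply symG_hom_ext
  intro i a
  change mu n G (diagAct n G g (s i a)) =
      SemidirectProduct.inl g * mu n G (s i a) * (SemidirectProduct.inl g)⁻¹
  have h1 : lo i ≠ hi i := by simp [lo, hi]
  rw [diagAct_s, mu_s, mu_s, ← map_inv]
  ext k
  · simp only [SemidirectProduct.mul_left, SemidirectProduct.left_inl,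
      SemidirectProduct.right_inl, SemidirectProduct.mul_right, map_one, MulAut.one_apply,
      Pi.mul_apply, arrow_apply, one_mul, Pi.inv_apply,
      Equiv.swap_inv, Equiv.swap_apply_def, Pi.mulSingle_apply]
    generalize lo i = p at *
    generalize hi i = q at *
    split_ifs <;> simp_all [mul_assoc]
  · simp

theorem mu_act (hn : 3 ≤ n) (w : Wreath n G) (m : SymG n G) :
    mu n G (act hn G w m) = w * mu n G m * w⁻¹ := by
  conv_lhs => rw [← SemidirectProduct.inl_left_mul_inr_right w]
  conv_rhs => rw [← SemidirectProduct.inl_left_mul_inr_right w]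
  rw [map_mul, MulAut.mul_apply, act_inl, act_inr, mu_diagAct, map_mul, map_mul, map_inv, mu_hat]
  simp only [mul_inv_rev, mul_assoc]

end ParamSymm

/-! ### Crossed modules with a commutator pairing, and adjoining lifts -/

namespace ParamSymm

/-- An action by automorphisms from a homomorphism to the endomorphism monoid. -/
def mulAutOfEnd {W M : Type*} [Group W] [Group M] (θ : W →* Monoid.End M) : W →* MulAut M where
  toFun w :=
    { (θ w : M →* M) with
      invFun := θ w⁻¹
      left_inv := fun m => by
        change (θ w⁻¹ * θ w) m = m
        rw [← map_mul, inv_mul_cancel, map_one]; rfl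
      right_inv := fun m => by
        change (θ w * θ w⁻¹) m = m
        rw [← map_mul, mul_inv_cancel, map_one]; rfl }
  map_one' := by
    ext m
    exact DFunLike.congr_fun (map_one θ) m
  map_mul' v w := by
    ext m
    exact DFunLike.congr_fun (map_mul θ v w) m

variable {S W G : Type u} [Group S] [Group W] [Group G]

/-- A crossed module `mu : S → W` with a lift `Λ w x` to `S` of the commutators `[w, κ x]`, where
`κ : G → W` is a homomorphism. -/
structure CommutatorPairing (mu : S →* W) (act : W →* MulAut S) (κ : G →* W) (Λ : W → G → S) :
    Prop where
  equivariant : ∀ w m, mu (act w m) = w * mu m * w⁻¹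
  peiffer : ∀ m' m, act (mu m') m = m' * m * m'⁻¹
  mul_left : ∀ w w' x, Λ (w * w') x = act w (Λ w' x) * Λ w x
  mul_right : ∀ w x y, Λ w (x * y) = Λ w x * act (κ x) (Λ w y)
  map_pairing : ∀ w x, mu (Λ w x) = w * κ x * w⁻¹ * (κ x)⁻¹
  pairing_map : ∀ m x, Λ (mu m) x = m * (act (κ x) m)⁻¹
  pairing_self : ∀ x, Λ (κ x) x = 1

variable {mu : S →* W} {act : W →* MulAut S} {κ : G →* W} {Λ : W → G → S}

namespace CommutatorPairing

theorem one_left (h : CommutatorPairing mu act κ Λ) (x : G) : Λ 1 x = 1 := by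
  simpa using h.mul_left 1 1 x

theorem one_right (h : CommutatorPairing mu act κ Λ) (w : W) : Λ w 1 = 1 := by
  simpa using h.mul_right w 1 1

theorem inv_left_eq_one (h : CommutatorPairing mu act κ Λ) {w : W} {x : G}
    (hw : Λ w x = 1) : Λ w⁻¹ x = 1 := by
  have := h.mul_left w w⁻¹ x
  rw [mul_inv_cancel, h.one_left, hw, mul_one] at this
  simpa using this.symm

theorem inv_right_eq_one (h : CommutatorPairing mu act κ Λ) {w : W} {x : G}
    (hw : Λ w x = 1) : Λ w x⁻¹ = 1 := by
  have := h.mul_right w x x⁻¹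
  rw [mul_inv_cancel, h.one_right, hw, one_mul] at this
  simpa using this.symm

/-- With one argument fixed, the rules for products make the vanishing locus a subgroup. This is the
Peiffer identity between powers of an adjoined lift. -/
theorem eq_one_of_mem_zpowers (h : CommutatorPairing mu act κ Λ) {x y z : G}
    (hy : y ∈ Subgroup.zpowers x)
    (hz : z ∈ Subgroup.zpowers x) : Λ (κ y) z = 1 := by
  let K : Subgroup G :=
    { carrier := {z | Λ (κ x) z = 1}
      mul_mem' := fun {a b} ha hb => by
        rw [Set.mem_ofPred_eq] at ha hb ⊢
        rw [h.mul_right, ha, hb, map_one, one_mul]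
      one_mem' := h.one_right _
      inv_mem' := fun ha => h.inv_right_eq_one ha }
  let K' : Subgroup G :=
    { carrier := {y | Λ (κ y) z = 1}
      mul_mem' := fun {a b} ha hb => by
        rw [Set.mem_ofPred_eq] at ha hb ⊢
        rw [map_mul, h.mul_left, ha, hb, map_one, one_mul]
      one_mem' := by
        rw [Set.mem_ofPred_eq, map_one]
        exact h.one_left _
      inv_mem' := fun {a} ha => by
        rw [Set.mem_ofPred_eq] at ha ⊢
        rw [map_inv]
        exact h.inv_left_eq_one ha }
  have h1 : Subgroup.zpowers x ≤ K := by
    rw [Subgroup.zpowers_le]; exact h.pairing_self x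
  have h2 : Subgroup.zpowers x ≤ K' := by
    rw [Subgroup.zpowers_le]; exact h1 hz
  exact h2 hy

/-- Polarization: expand Λ (κ (x y)) (x y) = 1. -/
theorem antisymm (h : CommutatorPairing mu act κ Λ) (x y : G) : (Λ (κ y) x)⁻¹ = Λ (κ x) y := by
  have := h.pairing_self (x * y)
  rw [map_mul, h.mul_left, h.mul_right, h.mul_right, h.pairing_self, h.pairing_self, map_one,
    mul_one, one_mul, ← map_mul, EmbeddingLike.map_eq_one_iff] at this
  exact inv_eq_of_mul_eq_one_right this

end CommutatorPairing

/-- A crossed module over `W` containing `S`, in which the commutators with lifts of `κ x` are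
given by `Λ`. -/
structure PairingExtension (mu : S →* W) (act : W →* MulAut S) (κ : G →* W) (Λ : W → G → S) where
  /-- The underlying group. -/
  T : Type u
  /-- The group structure. -/
  [group : Group T]
  /-- The structure homomorphism. -/
  p : T →* W
  /-- The action. -/
  a : W →* MulAut T
  /-- The inclusion of `S`. -/
  j : S →* T
  injective : Function.Injective j
  p_j : ∀ m, p (j m) = mu m
  j_act : ∀ w m, j (act w m) = a w (j m)
  equivariant : ∀ w t, p (a w t) = w * p t * w⁻¹
  peiffer : ∀ t' t, a (p t') t = t' * t * t'⁻¹
  pairing : ∀ t x, j (Λ (p t) x) = t * (a (κ x) t)⁻¹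

attribute [instance] PairingExtension.group

namespace PairingExtension

variable (h : CommutatorPairing mu act κ Λ)

/-- The trivial extension. -/
def base : PairingExtension mu act κ Λ where
  T := S
  p := mu
  a := act
  j := MonoidHom.id S
  injective := fun _ _ h => h
  p_j _ := rfl
  j_act _ _ := rfl
  equivariant := h.equivariant
  peiffer := h.peiffer
  pairing := h.pairing_map

variable (e : PairingExtension mu act κ Λ)

/-- The powers of `x`. -/
abbrev powHom (x : G) : Multiplicative ℤ →* G := zpowersHom G x

theorem powHom_mem (x : G) (k : Multiplicative ℤ) : powHom x k ∈ Subgroup.zpowers x :=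
  ⟨k.toAdd, rfl⟩

/-- The group obtained by adjoining a lift of `κ x`. -/
abbrev adjoinGroup (x : G) : Type u :=
  e.T ⋊[e.a.comp (κ.comp (powHom x))] Multiplicative ℤ

/-- The Peiffer identity for the lift of the commutator of w and κ x: conjugating by it interchanges
the two actions. This makes the action on the enlarged group multiplicative. -/
theorem j_pairing_mul (h : CommutatorPairing mu act κ Λ) (e : PairingExtension mu act κ Λ)
    (w : W) (x : G) (t : e.T) :
    e.j (Λ w x) * e.a (κ x) (e.a w t) = e.a w (e.a (κ x) t) * e.j (Λ w x) := by
  have h1 := e.peiffer (e.j (Λ w x)) (e.a (κ x) (e.a w t))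
  rw [e.p_j, h.map_pairing, ← MulAut.mul_apply, ← MulAut.mul_apply, ← map_mul, ← map_mul,
    eq_mul_inv_iff_mul_eq, inv_mul_cancel_right, inv_mul_cancel_right, map_mul,
    MulAut.mul_apply] at h1
  exact h1.symm

/-- The action of `w` on the group with a lift of `κ x` adjoined. -/
def adjoinEnd (x : G) (w : W) : e.adjoinGroup x →* e.adjoinGroup x where
  -- Forced by what Λ stands for: acting by w must multiply the lift of κ (x ^ k) on the left by Λ w
  -- (x ^ k).
  toFun t := ⟨e.a w t.left * e.j (Λ w (powHom x t.right)), t.right⟩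
  map_one' := by
    ext
    · simp [h.one_right]
    · rfl
  map_mul' t t' := by
    ext
    · simp only [SemidirectProduct.mul_left, SemidirectProduct.mul_right, map_mul, h.mul_right,
        MonoidHom.comp_apply, e.j_act]
      simp only [mul_assoc]
      rw [← mul_assoc (e.j _) (e.a _ (e.a _ _)), j_pairing_mul h e w]
      simp only [mul_assoc]
    · rfl

theorem adjoinEnd_left (x : G) (w : W) (t : e.adjoinGroup x) :
    (adjoinEnd h e x w t).left = e.a w t.left * e.j (Λ w (powHom x t.right)) := rfl

theorem adjoinEnd_right (x : G) (w : W) (t : e.adjoinGroup x) :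
    (adjoinEnd h e x w t).right = t.right := rfl

/-- The action of `W` on the group with a lift of `κ x` adjoined. -/
def adjoinAct (x : G) : W →* MulAut (e.adjoinGroup x) :=
  mulAutOfEnd
    { toFun := adjoinEnd h e x
      map_one' := by
        refine MonoidHom.ext fun t => ?_
        ext
        · rw [adjoinEnd_left, h.one_left, map_one, map_one, mul_one]; rfl
        · rfl
      map_mul' := fun v w => by
        refine MonoidHom.ext fun t => ?_
        ext
        · change _ = (adjoinEnd h e x v (adjoinEnd h e x w t)).left
          simp only [adjoinEnd_left, adjoinEnd_right, h.mul_left, map_mul, MulAut.mul_apply,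
            e.j_act, mul_assoc]
        · rfl }

theorem adjoinAct_left (x : G) (w : W) (t : e.adjoinGroup x) :
    (adjoinAct h e x w t).left = e.a w t.left * e.j (Λ w (powHom x t.right)) := rfl

theorem adjoinAct_right (x : G) (w : W) (t : e.adjoinGroup x) :
    (adjoinAct h e x w t).right = t.right := rfl

/-- The structure homomorphism of the group with a lift of `κ x` adjoined. -/
def adjoinHom (x : G) : e.adjoinGroup x →* W :=
  SemidirectProduct.lift e.p (κ.comp (powHom x)) fun k => by
    ext t
    exact e.equivariant _ _

theorem adjoinHom_apply (x : G) (t : e.adjoinGroup x) :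
    adjoinHom e x t = e.p t.left * κ (powHom x t.right) := rfl

/-- The extension with a lift of `κ x` adjoined. -/
def adjoin (x : G) : PairingExtension mu act κ Λ where
  T := e.adjoinGroup x
  p := adjoinHom e x
  a := adjoinAct h e x
  j := SemidirectProduct.inl.comp e.j
  injective := SemidirectProduct.inl_injective.comp e.injective
  p_j m := by simp [adjoinHom, e.p_j]
  j_act w m := by
    ext
    · simp [adjoinAct_left, e.j_act, h.one_right]
    · rfl
  equivariant w t := by
    rw [adjoinHom_apply, adjoinHom_apply, adjoinAct_left, adjoinAct_right, map_mul,
      e.equivariant, e.p_j, h.map_pairing]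
    group
  -- Checked on the two factors of t' separately: `e.pairing` handles the old group, vanishing of Λ
  -- on powers of x handles ℤ.
  peiffer t' t := by
    have h1 : ∀ (u : e.T) (t : e.adjoinGroup x),
        adjoinAct h e x (e.p u) t = SemidirectProduct.inl u * t * (SemidirectProduct.inl u)⁻¹ := by
      intro u t
      ext
      · rw [adjoinAct_left, e.pairing, e.peiffer, ← map_inv]
        simp [mul_assoc]
      · simp [adjoinAct_right]
    have h2 : ∀ (k : Multiplicative ℤ) (t : e.adjoinGroup x),
        adjoinAct h e x (κ (powHom x k)) t =
          SemidirectProduct.inr k * t * (SemidirectProduct.inr k)⁻¹ := by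
      intro k t
      ext
      · rw [adjoinAct_left, h.eq_one_of_mem_zpowers (powHom_mem x k) (powHom_mem x _), ← map_inv]
        simp
      · rw [adjoinAct_right, ← map_inv]
        simp
    rw [adjoinHom_apply, map_mul, MulAut.mul_apply, h1, h2]
    conv_rhs => rw [← SemidirectProduct.inl_left_mul_inr_right t']
    simp only [mul_inv_rev, mul_assoc]
  -- The adjoined part contributes Λ (κ y) (x ^ k) through the action, while Λ (κ (x ^ k)) y is
  -- wanted; antisymmetry exchanges them.
  pairing t y := by
    have h1 : (Λ (κ y) (powHom x t.right))⁻¹ = Λ (κ (powHom x t.right)) y := h.antisymm _ _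
    have h2 := e.pairing t.left y
    rw [adjoinHom_apply, h.mul_left]
    ext
    · simp only [MonoidHom.comp_apply, SemidirectProduct.left_inl, SemidirectProduct.mul_left,
        SemidirectProduct.inv_left, adjoinAct_left, adjoinAct_right, map_mul, e.j_act, h2,
        e.peiffer, mul_inv_rev, ← h1, map_inv]
      simp [mul_assoc]
    · simp [adjoinAct_right]

theorem exists_finset (h : CommutatorPairing mu act κ Λ) [DecidableEq G] (X : Finset G) :
    ∃ e : PairingExtension mu act κ Λ, ∀ x ∈ X, ∃ t, e.p t = κ x := by
  induction X using Finset.induction_on with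
  | empty => exact ⟨base h, by simp⟩
  | insert x X _ ih =>
    obtain ⟨e, he⟩ := ih
    refine ⟨adjoin h e x, fun y hy => ?_⟩
    rcases Finset.mem_insert.1 hy with rfl | hy
    · refine ⟨SemidirectProduct.inr (Multiplicative.ofAdd 1), ?_⟩
      change adjoinHom e y _ = _
      rw [adjoinHom_apply]
      simp
    · obtain ⟨t, ht⟩ := he y hy
      refine ⟨SemidirectProduct.inl t, ?_⟩
      change adjoinHom e x _ = _
      rw [adjoinHom_apply]
      simp [ht]

theorem mem_center_of_p_eq_one {t : e.T} (ht : e.p t = 1) (t' : e.T) : t' * t = t * t' := by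
  have := e.peiffer t t'
  rw [ht, map_one, MulAut.one_apply, eq_mul_inv_iff_mul_eq] at this
  exact this

end PairingExtension

/-- The elements of a product of groups that are eventually trivial. -/
def eventuallyOne {ι : Type*} (l : Filter ι) (T : ι → Type*) [∀ i, Group (T i)] :
    Subgroup (∀ i, T i) where
  carrier := {f | ∀ᶠ i in l, f i = 1}
  mul_mem' hf hg := by
    filter_upwards [hf, hg] with i h1 h2
    simp [h1, h2]
  one_mem' := by simp
  inv_mem' hf := by
    filter_upwards [hf] with i h1
    simp [h1]

theorem mem_eventuallyOne {ι : Type*} {l : Filter ι} {T : ι → Type*} [∀ i, Group (T i)]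
    {f : ∀ i, T i} : f ∈ eventuallyOne l T ↔ ∀ᶠ i in l, f i = 1 := Iff.rfl

instance {ι : Type*} (l : Filter ι) (T : ι → Type*) [∀ i, Group (T i)] :
    (eventuallyOne l T).Normal where
  conj_mem f hf g := by
    rw [mem_eventuallyOne] at hf ⊢
    filter_upwards [hf] with i h1
    simp [h1]

theorem mk_eq_mk_of_eventually {ι : Type*} {l : Filter ι} {T : ι → Type*} [∀ i, Group (T i)]
    {f g : ∀ i, T i} (h : ∀ᶠ i in l, f i = g i) :
    (f : (∀ i, T i) ⧸ eventuallyOne l T) = g := by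
  rw [QuotientGroup.eq, mem_eventuallyOne]
  filter_upwards [h] with i h1
  simp [h1]

/-- The extensions for different finite sets come with no compatible maps, so instead of a direct
limit T is their product modulo eventual triviality. Each identity involves finitely many elements
of G, hence holds for all large finite sets. The defect of multiplicativity is central because
elements over 1 ∈ W are, by the Peiffer identity. -/
theorem CommutatorPairing.exists_lift (h : CommutatorPairing mu act κ Λ) :
    ∃ (T : Type u) (_ : Group T) (j : S →* T) (ι : G → T), Function.Injective j ∧
      (∀ x y, ι x * ι y * (ι (x * y))⁻¹ ∈ Subgroup.center T) ∧
      (∀ x m, ι x * j m * (ι x)⁻¹ = j (act (κ x) m)) ∧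
      ∀ m x y, Λ (mu m * κ x * (mu m)⁻¹) y = 1 → Commute (j m * ι x * (j m)⁻¹) (ι y) := by
  classical
  choose e he using PairingExtension.exists_finset h
  -- For x outside X the value t X x is arbitrary; this is harmless, as x ∈ X eventually.
  choose! t ht using he
  have ev : ∀ x, ∀ᶠ X : Finset G in Filter.atTop, (e X).p (t X x) = κ x := fun x => by
    filter_upwards [Filter.eventually_ge_atTop {x}] with X hX
    exact ht X x (hX (Finset.mem_singleton_self x))
  let N := eventuallyOne (Filter.atTop : Filter (Finset G)) fun X => (e X).T
  refine ⟨(∀ X, (e X).T) ⧸ N, inferInstance,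
    (QuotientGroup.mk' N).comp (MonoidHom.mk' (fun m X => (e X).j m) fun a b => by
      ext X; simp),
    fun x => ((fun X => t X x : ∀ X, (e X).T) : (∀ X, (e X).T) ⧸ N), ?_, ?_, ?_, ?_⟩
  · rw [injective_iff_map_eq_one]
    intro m hm
    have h1 := (QuotientGroup.eq_one_iff _).1 hm
    obtain ⟨X, hX⟩ := (mem_eventuallyOne.1 h1).exists
    exact (injective_iff_map_eq_one _).1 (e X).injective m hX
  · intro x y
    rw [Subgroup.mem_center_iff]
    intro g
    obtain ⟨g, rfl⟩ := QuotientGroup.mk_surjective g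
    refine mk_eq_mk_of_eventually ?_
    filter_upwards [ev x, ev y, ev (x * y)] with X h1 h2 h3
    exact (e X).mem_center_of_p_eq_one (by simp [h1, h2, h3]) _
  · intro x m
    refine mk_eq_mk_of_eventually ?_
    filter_upwards [ev x] with X h1
    change t X x * (e X).j m * (t X x)⁻¹ = (e X).j (act (κ x) m)
    rw [(e X).j_act, ← h1, (e X).peiffer]
  · intro m x y hm
    refine mk_eq_mk_of_eventually ?_
    filter_upwards [ev x, ev y] with X h1 h2
    have h3 := (e X).pairing ((e X).j m * t X x * ((e X).j m)⁻¹) y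
    rw [map_mul, map_mul, map_inv, (e X).p_j, h1, hm, map_one, eq_comm, mul_inv_eq_one, ← h2,
      (e X).peiffer, eq_mul_inv_iff_mul_eq] at h3
    exact h3

end ParamSymm

/-! ### The commutator pairing on S_n(G) -/

namespace ParamSymm

variable {n : ℕ} {G : Type u} [Group G]

section Indices

/-- The index of the first generator. -/
def ia (hn : 3 ≤ n) : Fin (n - 1) := ⟨0, by omega⟩

/-- The index of the second generator. -/
def ib (hn : 3 ≤ n) : Fin (n - 1) := ⟨1, by omega⟩

/-- The first point. -/
def pa (hn : 3 ≤ n) : Fin n := ⟨0, by omega⟩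

/-- The second point. -/
def pb (hn : 3 ≤ n) : Fin n := ⟨1, by omega⟩

/-- The third point. -/
def pc (hn : 3 ≤ n) : Fin n := ⟨2, by omega⟩

variable (hn : 3 ≤ n)

theorem lo_ia : lo (ia hn) = pa hn := rfl
theorem hi_ia : hi (ia hn) = pb hn := rfl
theorem lo_ib : lo (ib hn) = pb hn := rfl
theorem hi_ib : hi (ib hn) = pc hn := rfl

theorem pa_ne_pb : pa hn ≠ pb hn := by simp [pa, pb]
theorem pa_ne_pc : pa hn ≠ pc hn := by simp [pa, pc]
theorem pb_ne_pc : pb hn ≠ pc hn := by simp [pb, pc]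

theorem s_conj_ia_ib (a b d : G) : s (ia hn) a * s (ib hn) b * s (ia hn) a =
    s (ib hn) d * s (ia hn) (a * b * d⁻¹) * s (ib hn) d :=
  s_conj_succ (ia hn) (ib hn) rfl a b d

theorem diagAct_ia (g : Fin n → G) (a : G) :
    diagAct n G g (s (ia hn) a) = s (ia hn) (g (pa hn) * a * (g (pb hn))⁻¹) :=
  diagAct_s g _ a

theorem diagAct_ib (g : Fin n → G) (a : G) :
    diagAct n G g (s (ib hn) a) = s (ib hn) (g (pb hn) * a * (g (pc hn))⁻¹) :=
  diagAct_s g _ a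

end Indices

section Elements

variable (hn : 3 ≤ n)

/-- A lift of the vector with entries `1, a, a⁻¹` at the first three places. -/
def liftBC (a : G) : SymG n G := s (ib hn) a * s (ib hn) 1

/-- A lift of the vector with entries `a, a⁻¹, 1` at the first three places. -/
def liftAB (a : G) : SymG n G := s (ia hn) a * s (ia hn) 1

/-- A lift of the vector with entries `a, 1, a⁻¹` at the first three places. -/
def liftAC (a : G) : SymG n G := s (ia hn) 1 * liftBC hn a * s (ia hn) 1

theorem liftAC_eq_conj (a : G) : liftAC hn a = s (ib hn) 1 * liftAB hn a * s (ib hn) 1 := by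
  have h1 := s_conj_ia_ib hn 1 a 1
  have h2 := s_conj_ia_ib hn (1 : G) 1 1
  simp only [one_mul, inv_one, mul_one] at h1 h2
  have e1 : liftAC hn a = (s (ia hn) 1 * s (ib hn) a * s (ia hn) 1) *
      (s (ia hn) 1 * s (ib hn) 1 * s (ia hn) 1) := by
    simp only [liftAC, liftBC, mul_assoc, s_mul_s_mul]
  rw [e1, h1, h2]
  simp only [liftAB, mul_assoc, s_mul_s_mul]

/-- Conjugating s_0(1) by `liftBC hn a` gives s_0(a⁻¹), which `s_conj_self` rewrites as s_0(1)
s_0(a) s_0(1). -/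
theorem liftAC_eq_mul (a : G) : liftAC hn a = liftAB hn a * liftBC hn a := by
  have h1 := s_conj_ia_ib hn (1 : G) 1 a
  simp only [one_mul] at h1
  have h2 := s_conj_self hn (ia hn) 1 a
  simp only [one_mul, mul_one] at h2
  have h3 : s (ib hn) a * s (ib hn) 1 * s (ia hn) 1 * s (ib hn) 1 * s (ib hn) a =
      s (ia hn) a⁻¹ := by
    have h4 := s_conj_ia_ib hn (1 : G) 1 1
    simp only [one_mul, inv_one] at h4
    have : s (ib hn) a * s (ib hn) 1 * s (ia hn) (1 : G) * s (ib hn) 1 * s (ib hn) a =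
        s (ib hn) a * (s (ib hn) 1 * s (ia hn) 1 * s (ib hn) 1) * s (ib hn) a := by
      simp only [mul_assoc]
    rw [this, ← h4, h1]
    simp only [mul_assoc, s_mul_s_mul, s_sq, mul_one]
  rw [← h2] at h3
  have h5 := congrArg (s (ia hn) 1 * · * s (ib hn) a * s (ib hn) 1) h3
  simp only [mul_assoc, s_mul_s_mul, s_sq, mul_one] at h5
  simpa only [liftAC, liftAB, liftBC, mul_assoc, mul_one] using h5

theorem mu_liftAB (a : G) : mu n G (liftAB hn a) =
    SemidirectProduct.inl (Pi.mulSingle (pa hn) a * Pi.mulSingle (pb hn) a⁻¹) := by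
  rw [liftAB, map_mul, mu_s, mu_s]
  ext <;> simp [lo_ia, hi_ia]

theorem mu_liftBC (a : G) : mu n G (liftBC hn a) =
    SemidirectProduct.inl (Pi.mulSingle (pb hn) a * Pi.mulSingle (pc hn) a⁻¹) := by
  rw [liftBC, map_mul, mu_s, mu_s]
  ext <;> simp [lo_ib, hi_ib]

theorem mu_liftAC (a : G) : mu n G (liftAC hn a) =
    SemidirectProduct.inl (Pi.mulSingle (pa hn) a * Pi.mulSingle (pc hn) a⁻¹) := by
  rw [liftAC_eq_mul, map_mul, mu_liftAB, mu_liftBC, ← map_mul]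
  congr 1
  simp only [Pi.mulSingle_inv]
  group

theorem diagAct_liftAB (g : Fin n → G) (ha : g (pa hn) = 1) (hb : g (pb hn) = 1) (a : G) :
    diagAct n G g (liftAB hn a) = liftAB hn a := by
  simp [liftAB, diagAct_ia, ha, hb]

/-- The entry at the second place need not be trivial: it is absorbed by the free parameter of
`s_conj_succ`. -/
theorem diagAct_liftAC (g : Fin n → G) (ha : g (pa hn) = 1) (hc : g (pc hn) = 1) (a : G) :
    diagAct n G g (liftAC hn a) = liftAC hn a := by
  have h1 := s_conj_ia_ib hn 1 a (g (pb hn))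
  have h2 := s_conj_ia_ib hn 1 1 (g (pb hn))
  simp only [one_mul] at h1 h2
  have e1 : liftAC hn a = (s (ia hn) 1 * s (ib hn) a * s (ia hn) 1) *
      (s (ia hn) 1 * s (ib hn) 1 * s (ia hn) 1) := by
    simp only [liftAC, liftBC, mul_assoc, s_mul_s_mul]
  rw [liftAC_eq_conj]
  simp only [liftAB, map_mul, diagAct_ia, diagAct_ib, ha, hc, one_mul, mul_one, inv_one]
  rw [← liftAB, ← liftAC_eq_conj, e1, h1, h2]
  simp only [mul_assoc, s_mul_s_mul]

end Elements

section Delta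

/-- The elements of `Gⁿ ⊆ G ≀ S_n` supported at the first place. -/
def kappa (hn : 3 ≤ n) (G : Type u) [Group G] : G →* Wreath n G :=
  SemidirectProduct.inl.comp (MonoidHom.mulSingle (fun _ : Fin n => G) (pa hn))

variable (hn : 3 ≤ n)

theorem kappa_apply (x : G) :
    kappa hn G x = SemidirectProduct.inl (Pi.mulSingle (pa hn) x) := rfl

/-- The lift `m (m ^ x)⁻¹` of the commutator of `mu m` and `x` at the first place. -/
noncomputable def delta (x : G) (m : SymG n G) : SymG n G := m * (act hn G (kappa hn G x) m)⁻¹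

theorem delta_mul (x : G) (m m' : SymG n G) :
    delta hn x (m * m') = m * delta hn x m' * m⁻¹ * delta hn x m := by
  simp only [delta, map_mul]
  group

theorem delta_mul_of_eq_one {x : G} {m m' : SymG n G} (h : delta hn x m' = 1) :
    delta hn x (m * m') = delta hn x m := by
  simp [delta_mul, h]

theorem delta_mul_of_eq_one' {x : G} {m m' : SymG n G} (h : delta hn x m = 1) :
    delta hn x (m * m') = m * delta hn x m' * m⁻¹ := by
  simp [delta_mul, h]

theorem delta_mul_left (x y : G) (m : SymG n G) :
    delta hn (x * y) m = delta hn x m * act hn G (kappa hn G x) (delta hn y m) := by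
  simp [delta, mul_assoc]

theorem delta_one (x : G) : delta hn x 1 = 1 := by simp [delta]

theorem delta_eq_one_iff {x : G} {m : SymG n G} :
    delta hn x m = 1 ↔ act hn G (kappa hn G x) m = m := by
  rw [delta, mul_inv_eq_one, eq_comm]

theorem mu_delta (x : G) (m : SymG n G) : mu n G (delta hn x m) =
    mu n G m * kappa hn G x * (mu n G m)⁻¹ * (kappa hn G x)⁻¹ := by
  rw [delta, map_mul, map_inv, mu_act]
  group

theorem act_kappa_s (x : G) (i : Fin (n - 1)) (hi : i ≠ ia hn) (a : G) :
    act hn G (kappa hn G x) (s i a) = s i a := by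
  have h0 : (i : ℕ) ≠ 0 := fun h => hi (Fin.ext h)
  have h1 : lo i ≠ pa hn := by
    intro h; exact h0 (congrArg Fin.val h)
  have h2 : ParamSymm.hi i ≠ pa hn := by
    intro h; exact absurd (congrArg Fin.val h) (Nat.succ_ne_zero _)
  rw [kappa_apply, act_inl, diagAct_s, Pi.mulSingle_eq_of_ne h1, Pi.mulSingle_eq_of_ne h2]
  simp

theorem delta_s (x : G) (i : Fin (n - 1)) (hi : i ≠ ia hn) (a : G) :
    delta hn x (s i a) = 1 :=
  (delta_eq_one_iff hn).2 (act_kappa_s hn x i hi a)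

theorem ib_ne_ia : ib hn ≠ ia hn := by simp [ia, ib]

theorem act_kappa_ia (x a : G) :
    act hn G (kappa hn G x) (s (ia hn) a) = s (ia hn) (x * a) := by
  rw [kappa_apply, act_inl, diagAct_ia, Pi.mulSingle_eq_same,
    Pi.mulSingle_eq_of_ne (pa_ne_pb hn).symm]
  simp

theorem delta_liftBC (x a : G) : delta hn x (liftBC hn a) = 1 := by
  rw [liftBC, delta_mul, delta_s _ _ _ (ib_ne_ia hn), delta_s _ _ _ (ib_ne_ia hn)]
  simp

theorem delta_liftAC (x a : G) : delta hn x (liftAC hn a) = delta hn x (liftAB hn a) := by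
  rw [liftAC_eq_mul, delta_mul_of_eq_one hn (delta_liftBC hn x a)]

theorem inl_mul_kappa_comm (g : Fin n → G) (hg : g (pa hn) = 1) (x : G) :
    SemidirectProduct.inl g * kappa hn G x = kappa hn G x * SemidirectProduct.inl g := by
  rw [kappa_apply, ← map_mul, ← map_mul]
  congr 1
  ext k
  by_cases h : k = pa hn
  · subst h; simp [hg]
  · simp [h]

theorem act_inl_delta (g : Fin n → G) (hg : g (pa hn) = 1) (x : G) (m : SymG n G) :
    diagAct n G g (delta hn x m) = delta hn x (diagAct n G g m) := by
  simp only [← act_inl hn]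
  rw [delta, delta, map_mul, map_inv, ← MulAut.mul_apply, ← MulAut.mul_apply, ← map_mul,
    ← map_mul, inl_mul_kappa_comm hn g hg]

/-- The lift of the commutator of `a` and `x` at the first place. -/
noncomputable def lam (a x : G) : SymG n G := delta hn x (liftAB hn a)

/-- Both `liftAB hn a` and `liftAC hn a` have `lam hn a x` as their δ. The first is fixed by vectors
trivial at places one and two, the second by those trivial at one and three; together these generate
all vectors trivial at the first place. -/
theorem diagAct_lam (g : Fin n → G) (hg : g (pa hn) = 1) (a x : G) :
    diagAct n G g (lam hn a x) = lam hn a x := by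
  obtain ⟨g', hg'⟩ : ∃ g', g' = (Pi.mulSingle (pb hn) (g (pb hn)) : Fin n → G)⁻¹ * g := ⟨_, rfl⟩
  have e : g = Pi.mulSingle (pb hn) (g (pb hn)) * g' := by rw [hg', mul_inv_cancel_left]
  have h1 : g' (pa hn) = 1 := by
    rw [hg', Pi.mul_apply, Pi.inv_apply, Pi.mulSingle_eq_of_ne (pa_ne_pb hn), hg]; simp
  have h2 : g' (pb hn) = 1 := by
    rw [hg', Pi.mul_apply, Pi.inv_apply, Pi.mulSingle_eq_same, inv_mul_cancel]
  rw [e, map_mul, MulAut.mul_apply]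
  have h3 : diagAct n G g' (lam hn a x) = lam hn a x := by
    rw [lam, act_inl_delta hn _ h1, diagAct_liftAB hn _ h1 h2]
  have h4 : (Pi.mulSingle (pb hn) (g (pb hn)) : Fin n → G) (pa hn) = 1 :=
    Pi.mulSingle_eq_of_ne (pa_ne_pb hn) _
  rw [h3, lam, ← delta_liftAC, act_inl_delta hn _ h4, diagAct_liftAC hn _ h4]
  exact Pi.mulSingle_eq_of_ne (pb_ne_pc hn).symm _

theorem diagAct_lam_eq (g : Fin n → G) (a x : G) :
    diagAct n G g (lam hn a x) = act hn G (kappa hn G (g (pa hn))) (lam hn a x) := by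
  obtain ⟨g', hg'⟩ : ∃ g', g' = (Pi.mulSingle (pa hn) (g (pa hn)) : Fin n → G)⁻¹ * g := ⟨_, rfl⟩
  have e : g = Pi.mulSingle (pa hn) (g (pa hn)) * g' := by rw [hg', mul_inv_cancel_left]
  have h1 : g' (pa hn) = 1 := by
    rw [hg', Pi.mul_apply, Pi.inv_apply, Pi.mulSingle_eq_same, inv_mul_cancel]
  conv_lhs => rw [e]
  rw [map_mul, MulAut.mul_apply, diagAct_lam hn _ h1, kappa_apply, act_inl]

/-- The vector (x, x⁻¹, 1) acts on `liftAC` as x[1] does, its second entry being invisible there;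
and it lies in the image of `mu`, so it acts by conjugation. -/
theorem act_kappa_liftAC (x a : G) : act hn G (kappa hn G x) (liftAC hn a) =
    liftAB hn x * liftAC hn a * (liftAB hn x)⁻¹ := by
  rw [← act_mu hn, mu_liftAB, map_mul, map_mul, MulAut.mul_apply, ← kappa_apply, act_inl,
    diagAct_liftAC]
  · exact Pi.mulSingle_eq_of_ne (pa_ne_pb hn) _
  · exact Pi.mulSingle_eq_of_ne (pb_ne_pc hn).symm _

theorem act_kappa_liftAB (x a : G) : act hn G (kappa hn G x) (liftAB hn a) =
    liftAC hn x * liftAB hn a * (liftAC hn x)⁻¹ := by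
  rw [← act_mu hn, mu_liftAC, map_mul, map_mul, MulAut.mul_apply, ← kappa_apply, act_inl,
    diagAct_liftAB]
  · exact Pi.mulSingle_eq_of_ne (pa_ne_pc hn) _
  · exact Pi.mulSingle_eq_of_ne (pb_ne_pc hn) _

/-- Both sides are the commutator of `liftAC hn a` and `liftAB hn x`. This form shows how `lam`
behaves under products in its first argument. -/
theorem lam_eq (a x : G) :
    lam hn a x = act hn G (kappa hn G a) (liftAB hn x) * (liftAB hn x)⁻¹ := by
  rw [lam, ← delta_liftAC, delta, act_kappa_liftAC, act_kappa_liftAB]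
  group

theorem lam_mul_left (a b x : G) :
    lam hn (a * b) x = act hn G (kappa hn G a) (lam hn b x) * lam hn a x := by
  simp [lam_eq, mul_assoc]

theorem lam_mul_right (a x y : G) :
    lam hn a (x * y) = lam hn a x * act hn G (kappa hn G x) (lam hn a y) :=
  delta_mul_left hn x y _

theorem lam_one (x : G) : lam hn 1 x = 1 := by
  rw [lam, liftAB, s_sq, delta_one]

/-- Acting by x[1] turns s_0(x) s_0(1) into s_0(x²) s_0(x), the same element by `s_conj_self`. -/
theorem lam_self (x : G) : lam hn x x = 1 := by
  rw [lam, delta_eq_one_iff, liftAB, map_mul, act_kappa_ia, act_kappa_ia]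
  have h := s_conj_self hn (ia hn) x 1
  rw [inv_one, mul_one] at h
  rw [mul_one, ← h]
  simp only [mul_assoc, s_sq, mul_one]

theorem mu_lam (g : Fin n → G) (x : G) : mu n G (lam hn (g (pa hn)) x) =
    SemidirectProduct.inl g * kappa hn G x * (SemidirectProduct.inl g)⁻¹ * (kappa hn G x)⁻¹ := by
  rw [lam, mu_delta, mu_liftAB, kappa_apply]
  simp only [← map_mul, ← map_inv]
  congr 1
  ext k
  by_cases h : k = pa hn
  · subst h
    simp [Pi.mulSingle_eq_of_ne (pa_ne_pb hn)]
  · simp [h]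

theorem act_lam (g : Fin n → G) (x : G) (m : SymG n G) :
    lam hn (g (pa hn)) x * act hn G (kappa hn G x) (diagAct n G g m) =
      diagAct n G g (act hn G (kappa hn G x) m) * lam hn (g (pa hn)) x := by
  have h := act_mu hn (lam hn (g (pa hn)) x) (act hn G (kappa hn G x) (diagAct n G g m))
  rw [mu_lam, ← act_inl hn, ← MulAut.mul_apply, ← MulAut.mul_apply, ← map_mul, ← map_mul,
    eq_mul_inv_iff_mul_eq, inv_mul_cancel_right, inv_mul_cancel_right, map_mul,
    MulAut.mul_apply, act_inl] at h
  rw [← act_inl hn g m]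
  exact h.symm

end Delta

section Pairing

variable (hn : 3 ≤ n)

/-- The lift of the commutators `[w, x]`, where `x` stands at the first place. -/
noncomputable def pairing (w : Wreath n G) (x : G) : SymG n G :=
  diagAct n G w.left (delta hn x (hat n G w.right)) * lam hn (w.left (pa hn)) x

/-- Conjugation by s_i(1) commutes with δ here. For i = 1 it turns `liftAB` into `liftAC`, with the
same δ; for i ≥ 2 it fixes `liftAB`. -/
theorem conj_s_lam_of_ne (i : Fin (n - 1)) (hi : i ≠ ia hn) (a x : G) :
    s i 1 * lam hn a x * (s i 1)⁻¹ = lam hn a x := by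
  have h0 : (i : ℕ) ≠ 0 := fun h => hi (Fin.ext h)
  have h1 : ∀ m, s i 1 * delta hn x m * (s i 1)⁻¹ = delta hn x (s i 1 * m * (s i 1)⁻¹) :=
    fun m => by
      rw [s_inv, delta_mul_of_eq_one hn (delta_s hn x i hi 1),
        delta_mul_of_eq_one' hn (delta_s hn x i hi 1), s_inv]
  by_cases hb : i = ib hn
  · subst hb
    rw [lam, h1, s_inv, ← liftAC_eq_conj, delta_liftAC]
  · have hb' : (i : ℕ) ≠ 1 := fun h => hb (Fin.ext h)
    have h2 : ∀ a : G, s i 1 * s (ia hn) a = s (ia hn) a * s i 1 := fun a =>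
      s_comm i (ia hn) (Or.inr (by simp [ia]; omega)) 1 a
    rw [lam, h1, liftAB, ← mul_assoc, h2, mul_assoc, mul_assoc, ← mul_assoc (s i 1), h2]
    simp

theorem diagAct_delta_ia {g g' : Fin n → G} (ha : g (pa hn) = g' (pa hn))
    (hb : g (pb hn) = g' (pb hn)) (x : G) :
    diagAct n G g (delta hn x (s (ia hn) 1)) = diagAct n G g' (delta hn x (s (ia hn) 1)) := by
  rw [delta, act_kappa_ia, map_mul, map_mul, map_inv, map_inv, diagAct_ia, diagAct_ia,
    diagAct_ia, diagAct_ia, ha, hb]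

/-- Swapping the first two places turns `liftBC` into `liftAC`. Evaluating δ of s_0(1) liftAC(a) =
liftBC(a) s_0(1) and of s_0(1) liftBC(b) = liftAC(b) s_0(1), where a, b are the first two entries of
g, gives the two halves. -/
theorem conj_ia_lam (g : Fin n → G) (x : G) :
    s (ia hn) 1 * lam hn (g (pa hn)) x * (s (ia hn) 1)⁻¹ * delta hn x (s (ia hn) 1) =
      diagAct n G (mulAutArrow (Equiv.swap (pa hn) (pb hn)) g) (delta hn x (s (ia hn) 1)) *
        lam hn (g (pb hn)) x := by
  have h1 : s (ia hn) 1 * lam hn (g (pa hn)) x * (s (ia hn) 1)⁻¹ * delta hn x (s (ia hn) 1) =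
      liftBC hn (g (pa hn)) * delta hn x (s (ia hn) 1) * (liftBC hn (g (pa hn)))⁻¹ := by
    rw [lam, ← delta_liftAC, ← delta_mul, ← delta_mul_of_eq_one' hn (delta_liftBC hn x _)]
    congr 1
    simp only [liftAC, mul_assoc, s_mul_s_mul]
  have h2 : delta hn x (s (ia hn) 1) = liftAC hn (g (pb hn)) * delta hn x (s (ia hn) 1) *
      (liftAC hn (g (pb hn)))⁻¹ * lam hn (g (pb hn)) x := by
    rw [lam, ← delta_liftAC, ← delta_mul,
      ← delta_mul_of_eq_one hn (m := s (ia hn) 1) (delta_liftBC hn x (g (pb hn)))]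
    congr 1
    simp only [liftAC, mul_assoc, s_sq, mul_one]
  have h3 : liftBC hn (g (pa hn)) * lam hn (g (pb hn)) x * (liftBC hn (g (pa hn)))⁻¹ =
      lam hn (g (pb hn)) x := by
    rw [← act_mu hn, mu_liftBC, act_inl, diagAct_lam]
    simp [Pi.mulSingle_eq_of_ne (pa_ne_pb hn), Pi.mulSingle_eq_of_ne (pa_ne_pc hn)]
  have h4 : liftBC hn (g (pa hn)) * (liftAC hn (g (pb hn)) * delta hn x (s (ia hn) 1) *
      (liftAC hn (g (pb hn)))⁻¹) * (liftBC hn (g (pa hn)))⁻¹ =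
      diagAct n G (mulAutArrow (Equiv.swap (pa hn) (pb hn)) g) (delta hn x (s (ia hn) 1)) := by
    rw [← act_mu hn, ← act_mu hn, mu_liftBC, mu_liftAC, act_inl, act_inl, ← MulAut.mul_apply,
      ← map_mul]
    -- Only the first two entries matter: the vector is (b, a, a⁻¹ b⁻¹), which agrees there with g
    -- after the swap.
    apply diagAct_delta_ia
    · rw [arrow_apply, Equiv.swap_inv, Equiv.swap_apply_left]
      simp [pa_ne_pb hn, pa_ne_pc hn]
    · rw [arrow_apply, Equiv.swap_inv, Equiv.swap_apply_right]
      simp [(pa_ne_pb hn).symm, pb_ne_pc hn]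
  rw [h1, ← h4]
  conv_lhs => rw [h2]
  conv_rhs => rw [← h3]
  group

theorem conj_hat_lam (x : G) (σ : Equiv.Perm (Fin n)) : ∀ g : Fin n → G,
    hat n G σ * lam hn (g (pa hn)) x * (hat n G σ)⁻¹ * delta hn x (hat n G σ) =
      diagAct n G (mulAutArrow σ g) (delta hn x (hat n G σ)) *
        lam hn ((mulAutArrow σ : MulAut (Fin n → G)) g (pa hn)) x := by
  induction σ using perm_induction with
  | one => intro g; simp [delta_one]
  | mul i σ ih =>
    intro g
    have key : ∀ g : Fin n → G,
        s i 1 * lam hn (g (pa hn)) x * (s i 1)⁻¹ * delta hn x (s i 1) =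
        diagAct n G (mulAutArrow (Equiv.swap (lo i) (hi i)) g) (delta hn x (s i 1)) *
        lam hn ((mulAutArrow (Equiv.swap (lo i) (hi i)) : MulAut (Fin n → G)) g (pa hn)) x := by
      intro g
      by_cases h : i = ia hn
      · subst h
        rw [lo_ia, hi_ia, conj_ia_lam hn g x, arrow_apply, Equiv.swap_inv,
          Equiv.swap_apply_left]
      · have h0 : (i : ℕ) ≠ 0 := fun h' => h (Fin.ext h')
        have h1 : pa hn ≠ lo i := fun h => h0 (congrArg Fin.val h).symm
        have h2 : pa hn ≠ hi i := fun h => absurd (congrArg Fin.val h).symm (Nat.succ_ne_zero _)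
        rw [conj_s_lam_of_ne hn i h, delta_s hn x i h, map_one, arrow_apply, Equiv.swap_inv,
          Equiv.swap_apply_of_ne_of_ne h1 h2, one_mul, mul_one]
    rw [map_mul (hat n G), hat_swap, delta_mul, map_mul mulAutArrow, MulAut.mul_apply, map_mul,
      mul_assoc (diagAct n G _ _), ← key, ← conj_s_diagAct hn]
    have := congrArg (s i 1 * · * (s i 1)⁻¹ * delta hn x (s i 1)) (ih g)
    simp only [mul_assoc, mul_inv_rev, inv_mul_cancel_left] at this ⊢
    exact this

theorem pairing_mul_left (w w' : Wreath n G) (x : G) :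
    pairing hn (w * w') x = act hn G w (pairing hn w' x) * pairing hn w x := by
  obtain ⟨g, σ⟩ := w
  obtain ⟨g', σ'⟩ := w'
  have h1 := conj_hat_lam hn x σ g'
  have h2 := conj_hat_diagAct hn σ g' (delta hn x (hat n G σ'))
  rw [SemidirectProduct.mk_eq_inl_mul_inr σ g, map_mul, MulAut.mul_apply, act_inr, act_inl,
    ← SemidirectProduct.mk_eq_inl_mul_inr]
  simp only [pairing, SemidirectProduct.mul_left, SemidirectProduct.mul_right, Pi.mul_apply]
  rw [lam_mul_left, ← diagAct_lam_eq hn, ← mul_assoc, ← mul_assoc, map_mul (hat n G),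
    delta_mul, map_mul (diagAct n G), MulAut.mul_apply, ← map_mul (diagAct n G g),
    ← map_mul (diagAct n G g), map_mul (diagAct n G (mulAutArrow σ g')), ← h2, mul_assoc _ _
    (lam hn ((mulAutArrow σ : MulAut (Fin n → G)) g' (pa hn)) x), ← h1]
  congr 2
  group

theorem pairing_mul_right (w : Wreath n G) (x y : G) :
    pairing hn w (x * y) = pairing hn w x * act hn G (kappa hn G x) (pairing hn w y) := by
  simp only [pairing, lam_mul_right, delta_mul_left, map_mul]
  simp only [mul_assoc]
  rw [← mul_assoc (lam hn _ x) (act hn G (kappa hn G x) (diagAct n G _ _)), act_lam]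
  simp only [mul_assoc]

theorem mu_pairing (w : Wreath n G) (x : G) : mu n G (pairing hn w x) =
    w * kappa hn G x * w⁻¹ * (kappa hn G x)⁻¹ := by
  rw [pairing, map_mul, mu_diagAct, mu_delta, mu_lam, mu_hat]
  conv_rhs => rw [← SemidirectProduct.inl_left_mul_inr_right w]
  group

theorem pairing_mu_s (i : Fin (n - 1)) (a x : G) :
    pairing hn (mu n G (s i a)) x = delta hn x (s i a) := by
  by_cases h : i = ia hn
  · subst h
    have e : s (ia hn) a = liftAB hn a * s (ia hn) 1 := by
      simp only [liftAB, mul_assoc, s_sq, mul_one]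
    conv_rhs => rw [e, delta_mul, ← act_mu hn, mu_liftAB, act_inl]
    rw [mu_s, pairing]
    simp only [hat_swap]
    rw [lo_ia, hi_ia]
    rw [Pi.mul_apply, Pi.mulSingle_eq_same, Pi.mulSingle_eq_of_ne (pa_ne_pb hn), mul_one]
    rfl
  · have h0 : (i : ℕ) ≠ 0 := fun h' => h (Fin.ext h')
    have h1 : pa hn ≠ lo i := fun h => h0 (congrArg Fin.val h).symm
    have h2 : pa hn ≠ hi i := fun h => absurd (congrArg Fin.val h).symm (Nat.succ_ne_zero _)
    rw [mu_s, pairing]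
    simp only [hat_swap]
    rw [delta_s hn x i h, delta_s hn x i h, Pi.mul_apply, Pi.mulSingle_eq_of_ne h1,
      Pi.mulSingle_eq_of_ne h2, mul_one, lam_one, map_one, mul_one]

theorem pairing_inl (g : Fin n → G) (x : G) :
    pairing hn (SemidirectProduct.inl g) x = lam hn (g (pa hn)) x := by
  simp [pairing, delta_one]

theorem pairing_mu (m : SymG n G) (x : G) : pairing hn (mu n G m) x = delta hn x m := by
  induction m using symG_induction with
  | one => rw [map_one, ← map_one SemidirectProduct.inl, pairing_inl, Pi.one_apply, lam_one,
      delta_one]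
  | mul i a m ih => rw [map_mul, pairing_mul_left, ih, act_mu, pairing_mu_s, delta_mul]

theorem commutatorPairing (hn : 3 ≤ n) (G : Type u) [Group G] :
    CommutatorPairing (mu n G) (act hn G) (kappa hn G) (pairing hn) where
  equivariant := mu_act hn
  peiffer := act_mu hn
  mul_left := pairing_mul_left hn
  mul_right := pairing_mul_right hn
  map_pairing := mu_pairing hn
  pairing_map := pairing_mu hn
  pairing_self x := by rw [kappa_apply, pairing_inl, Pi.mulSingle_eq_same, lam_self]

/-- A permutation fixing the first point is a product of the s_i(1) with i ≥ 1, which do not involve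
the first place. -/
theorem act_kappa_hat (x : G) {ρ : Equiv.Perm (Fin n)} (hρ : ρ (pa hn) = pa hn) :
    act hn G (kappa hn G x) (hat n G ρ) = hat n G ρ := by
  have h : hat n G ρ ∈ tailSubgroup (refl n G) (n - 1) 1 :=
    mem_tailSubgroup_succ (by omega) (hat_mem ρ) (by rw [toPerm_hat]; exact hρ)
  refine Subgroup.closure_induction
    (p := fun m _ => act hn G (kappa hn G x) m = m) ?_ (map_one _) ?_ ?_ h
  · rintro _ ⟨i, hi, hN, rfl⟩
    rw [refl_of_lt hN]
    refine act_kappa_s hn x _ ?_ _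
    simp [ia]
    omega
  · intro a b _ _ ha hb
    rw [map_mul, ha, hb]
  · intro a _ ha
    rw [map_inv, ha]

end Pairing

end ParamSymm

/-! ### The universal cocycle extension and its abelianization -/

namespace ParamSymm

open groupHomology
open scoped IsMulCommutative

variable {G : Type u} [Group G]

/-- The trivial representation on the integers. -/
abbrev trivRep (G : Type u) [Group G] : Rep (ULift.{u} ℤ) G :=
  Rep.trivial (ULift.{u} ℤ) G (ULift.{u} ℤ)

/-- The group of inhomogeneous `2`-chains modulo boundaries. -/
abbrev ChainQuot (G : Type u) [Group G] : Type u :=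
  (G × G →₀ ULift.{u} ℤ) ⧸ (boundaries₂ (trivRep G)).toAddSubgroup

/-- The universal `2`-cocycle. -/
noncomputable def cocycle (g h : G) : ChainQuot G :=
  QuotientAddGroup.mk (Finsupp.single (g, h) (1 : ULift.{u} ℤ))

theorem d₃₂_trivRep_single (g h k : G) (a : ULift.{u} ℤ) :
    (d₃₂ (trivRep G)).hom (Finsupp.single (g, h, k) a) =
      (Finsupp.single (h, k) a - Finsupp.single (g * h, k) a + Finsupp.single (g, h * k) a -
        Finsupp.single (g, h) a : G × G →₀ ULift.{u} ℤ) :=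
  d₃₂_single (A := trivRep G) (g, h, k) a

theorem d₂₁_trivRep_single (g h : G) (a : ULift.{u} ℤ) :
    (d₂₁ (trivRep G)).hom (Finsupp.single (g, h) a) =
      (Finsupp.single h a - Finsupp.single (g * h) a + Finsupp.single g a :
        G →₀ ULift.{u} ℤ) :=
  d₂₁_single (A := trivRep G) (g, h) a

theorem cocycle_add (g h k : G) :
    cocycle g h + cocycle (g * h) k = cocycle h k + cocycle g (h * k) := by
  have h1 : (Finsupp.single (h, k) 1 - Finsupp.single (g * h, k) 1 +
      Finsupp.single (g, h * k) 1 - Finsupp.single (g, h) 1 : G × G →₀ ULift.{u} ℤ) ∈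
      (boundaries₂ (trivRep G)).toAddSubgroup :=
    ⟨Finsupp.single (g, h, k) (1 : ULift.{u} ℤ), d₃₂_trivRep_single g h k 1⟩
  have h2 := (QuotientAddGroup.eq_zero_iff _).2 h1
  rw [QuotientAddGroup.mk_sub, QuotientAddGroup.mk_add, QuotientAddGroup.mk_sub] at h2
  change cocycle h k - cocycle (g * h) k + cocycle g (h * k) - cocycle g h = 0 at h2
  rw [← sub_eq_zero, ← neg_eq_zero, ← h2]
  abel

theorem cocycle_one_left (g : G) : cocycle 1 g = cocycle (1 : G) 1 := by
  have h := cocycle_add 1 1 g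
  rw [one_mul, one_mul] at h
  exact (add_right_cancel h).symm

theorem ulift_single_eq {α : Type*} (x : α) (a : ULift.{u} ℤ) :
    (Finsupp.single x a : α →₀ ULift.{u} ℤ) = a.down • Finsupp.single x 1 := by
  rw [Finsupp.smul_single]
  congr 1
  ext
  simp

theorem ulift_finsupp_hom_ext {α : Type*} {B : Type*} [AddCommGroup B]
    {f f' : (α →₀ ULift.{u} ℤ) →+ B}
    (h : ∀ x, f (Finsupp.single x 1) = f' (Finsupp.single x 1)) : f = f' :=
  Finsupp.addHom_ext fun x a => by
    rw [ulift_single_eq, map_zsmul, map_zsmul, h]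

theorem chainQuot_hom_ext {B : Type*} [AddCommGroup B] {f f' : ChainQuot G →+ B}
    (h : ∀ x y, f (cocycle x y) = f' (cocycle x y)) : f = f' :=
  QuotientAddGroup.addMonoidHom_ext _ (ulift_finsupp_hom_ext fun x => h x.1 x.2)

/-- The homomorphism on finitely supported functions with given values on a basis. -/
noncomputable def finsuppLift {α : Type*} {B : Type*} [AddCommGroup B] (z : α → B) :
    (α →₀ ULift.{u} ℤ) →+ B :=
  Finsupp.liftAddHom fun x => (zmultiplesHom B (z x)).comp AddEquiv.ulift.toAddMonoidHom

theorem finsuppLift_single {α : Type*} {B : Type*} [AddCommGroup B] (z : α → B) (x : α) :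
    finsuppLift z (Finsupp.single x (1 : ULift.{u} ℤ)) = z x := by
  rw [finsuppLift, Finsupp.liftAddHom_apply_single]
  exact one_zsmul (z x)

/-- A homomorphism out of the `2`-chains modulo boundaries from a `2`-cocycle. -/
noncomputable def chainLift {B : Type*} [AddCommGroup B] (z : G → G → B)
    (hz : ∀ g h k, z g h + z (g * h) k = z h k + z g (h * k)) : ChainQuot G →+ B :=
  QuotientAddGroup.lift _ (finsuppLift fun x : G × G => z x.1 x.2) (by
    rintro _ ⟨y, rfl⟩
    have h : (finsuppLift fun x : G × G => z x.1 x.2).comp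
        ((d₃₂ (trivRep G)).hom.toAddMonoidHom :
          (G × G × G →₀ ULift.{u} ℤ) →+ (G × G →₀ ULift.{u} ℤ)) = 0 := by
      apply ulift_finsupp_hom_ext
      rintro ⟨g, h, k⟩
      change (finsuppLift fun x : G × G => z x.1 x.2)
        ((d₃₂ (trivRep G)).hom (Finsupp.single (g, h, k) (1 : ULift.{u} ℤ))) = 0
      rw [d₃₂_trivRep_single, map_sub, map_add, map_sub]
      simp only [finsuppLift_single]
      have := hz g h k
      rw [← sub_eq_zero, ← neg_eq_zero] at this
      rw [← this]
      abel
    exact DFunLike.congr_fun h y)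

theorem chainLift_cocycle {B : Type*} [AddCommGroup B] (z : G → G → B)
    (hz : ∀ g h k, z g h + z (g * h) k = z h k + z g (h * k)) (g h : G) :
    chainLift z hz (cocycle g h) = z g h :=
  finsuppLift_single _ _

/-- The central extension of `G` defined by the universal `2`-cocycle. -/
@[ext]
structure UnivExt (G : Type u) [Group G] where
  /-- The component in the kernel. -/
  coeff : ChainQuot G
  /-- The component in `G`. -/
  base : G

namespace UnivExt

noncomputable instance : Mul (UnivExt G) :=
  ⟨fun a b => ⟨a.coeff + b.coeff + cocycle a.base b.base, a.base * b.base⟩⟩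
-- The cocycle is not normalized, whence the corrections by `cocycle 1 1` here, in the inverse and
-- in `incl`.
noncomputable instance : One (UnivExt G) := ⟨⟨-cocycle 1 1, 1⟩⟩
noncomputable instance : Inv (UnivExt G) :=
  ⟨fun a => ⟨-a.coeff - cocycle a.base⁻¹ a.base - cocycle 1 1, a.base⁻¹⟩⟩

theorem mul_coeff (a b : UnivExt G) :
    (a * b).coeff = a.coeff + b.coeff + cocycle a.base b.base := rfl
theorem mul_base (a b : UnivExt G) : (a * b).base = a.base * b.base := rfl
theorem one_coeff : (1 : UnivExt G).coeff = -cocycle 1 1 := rfl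
theorem one_base : (1 : UnivExt G).base = 1 := rfl
theorem inv_coeff (a : UnivExt G) :
    a⁻¹.coeff = -a.coeff - cocycle a.base⁻¹ a.base - cocycle 1 1 := rfl
theorem inv_base (a : UnivExt G) : a⁻¹.base = a.base⁻¹ := rfl

noncomputable instance : Group (UnivExt G) :=
  Group.ofLeftAxioms
    (fun a b c => by
      ext
      · simp only [mul_coeff, mul_base]
        have := cocycle_add a.base b.base c.base
        calc _ = a.coeff + b.coeff + c.coeff +
              (cocycle a.base b.base + cocycle (a.base * b.base) c.base) := by abel
          _ = _ := by rw [this]; abel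
      · simp [mul_base, mul_assoc])
    (fun a => by
      ext
      · rw [mul_coeff, one_coeff, one_base, cocycle_one_left a.base]
        abel
      · simp [mul_base, one_base])
    (fun a => by
      ext
      · rw [mul_coeff, inv_coeff, inv_base, one_coeff]
        abel
      · simp [mul_base, one_base, inv_base])

/-- The projection to `G`. -/
def proj (G : Type u) [Group G] : UnivExt G →* G where
  toFun := base
  map_one' := rfl
  map_mul' _ _ := rfl

theorem proj_apply (a : UnivExt G) : proj G a = a.base := rfl

/-- The inclusion of the kernel. -/
noncomputable def incl (G : Type u) [Group G] : Multiplicative (ChainQuot G) →* UnivExt G where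
  toFun a := ⟨a.toAdd - cocycle 1 1, 1⟩
  map_one' := by
    ext
    · simp [one_coeff]
    · rfl
  map_mul' a b := by
    ext
    · simp only [mul_coeff, toAdd_mul]
      abel
    · simp [mul_base]

theorem incl_base (a : Multiplicative (ChainQuot G)) : (incl G a).base = 1 := rfl

theorem incl_coeff (a : Multiplicative (ChainQuot G)) :
    (incl G a).coeff = a.toAdd - cocycle 1 1 := rfl

theorem incl_injective : Function.Injective (incl G) := fun a b h => by
  have := congrArg coeff h
  rw [incl_coeff, incl_coeff] at this
  exact Multiplicative.toAdd.injective (sub_left_injective this)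

theorem exists_incl {a : UnivExt G} (h : a.base = 1) : ∃ b, incl G b = a :=
  ⟨Multiplicative.ofAdd (a.coeff + cocycle 1 1), by
    ext
    · rw [incl_coeff, toAdd_ofAdd, add_sub_cancel_right]
    · rw [incl_base, h]⟩

/-- The standard section. -/
noncomputable def sec (g : G) : UnivExt G := ⟨0, g⟩

theorem eq_incl_mul_sec (a : UnivExt G) :
    a = incl G (Multiplicative.ofAdd a.coeff) * sec a.base := by
  ext
  · rw [mul_coeff, incl_coeff, incl_base, cocycle_one_left (sec a.base).base]
    simp [sec]
  · simp [mul_base, incl_base, sec]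

theorem incl_comm (b : Multiplicative (ChainQuot G)) (a : UnivExt G) :
    incl G b * a = a * incl G b := by
  have h : cocycle a.base 1 = cocycle (1 : G) 1 := by
    have := cocycle_add a.base 1 1
    rw [mul_one, mul_one] at this
    exact add_right_cancel this
  ext
  · rw [mul_coeff, mul_coeff, incl_base, cocycle_one_left a.base, h]
    abel
  · simp [mul_base, incl_base]

theorem sec_mul_sec (g h : G) :
    sec g * sec h = incl G (Multiplicative.ofAdd (cocycle g h)) * sec (g * h) := by
  rw [eq_incl_mul_sec (sec g * sec h)]
  congr 2
  simp [mul_coeff, sec]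

section Lift

variable {T : Type*} [Group T] (ι : G → T)
  (hι : ∀ x y, ι x * ι y * (ι (x * y))⁻¹ ∈ Subgroup.center T)

theorem lift_cocycle (hι : ∀ x y, ι x * ι y * (ι (x * y))⁻¹ ∈ Subgroup.center T) (g h k : G) :
    Additive.ofMul (⟨_, hι g h⟩ : Subgroup.center T) + Additive.ofMul ⟨_, hι (g * h) k⟩ =
      Additive.ofMul (⟨_, hι h k⟩ : Subgroup.center T) + Additive.ofMul ⟨_, hι g (h * k)⟩ := by
  apply Additive.toMul.injective
  apply Subtype.ext
  change ι g * ι h * (ι (g * h))⁻¹ * (ι (g * h) * ι k * (ι (g * h * k))⁻¹) =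
    ι h * ι k * (ι (h * k))⁻¹ * (ι g * ι (h * k) * (ι (g * (h * k)))⁻¹)
  have h1 := Subgroup.mem_center_iff.1 (hι h k) (ι g)
  rw [← mul_assoc (ι h * ι k * (ι (h * k))⁻¹), ← mul_assoc (ι h * ι k * (ι (h * k))⁻¹), ← h1,
    mul_assoc g h k]
  group

/-- The homomorphism from the kernel to the center of `T`. -/
noncomputable def liftCenter : ChainQuot G →+ Additive (Subgroup.center T) :=
  chainLift (fun g h => Additive.ofMul (⟨_, hι g h⟩ : Subgroup.center T)) (lift_cocycle ι hι)

/-- The homomorphism to `T` from a map `G → T` that is multiplicative up to central elements. -/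
noncomputable def lift : UnivExt G →* T :=
  MonoidHom.mk' (fun a => ((liftCenter ι hι a.coeff).toMul : T) * ι a.base) fun a b => by
    have h1 : ((liftCenter ι hι (cocycle a.base b.base)).toMul : T) =
        ι a.base * ι b.base * (ι (a.base * b.base))⁻¹ := by
      rw [liftCenter, chainLift_cocycle]; rfl
    have h2 := Subgroup.mem_center_iff.1 (liftCenter ι hι b.coeff).toMul.2 (ι a.base)
    rw [mul_coeff, mul_base, map_add (liftCenter ι hι), map_add (liftCenter ι hι), toMul_add, toMul_add,
      Subgroup.coe_mul,
      Subgroup.coe_mul, h1]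
    simp only [mul_assoc, inv_mul_cancel, mul_one]
    rw [← mul_assoc (ι a.base), h2]
    simp only [mul_assoc]

theorem lift_sec (g : G) : lift ι hι (sec g) = ι g := by
  change ((liftCenter ι hι 0).toMul : T) * ι g = ι g
  simp

theorem exists_lift_eq (a : UnivExt G) :
    ∃ z ∈ Subgroup.center T, lift ι hι a = z * ι a.base :=
  ⟨_, (liftCenter ι hι a.coeff).toMul.2, rfl⟩

theorem lift_incl_mem_center (b : Multiplicative (ChainQuot G)) :
    lift ι hι (incl G b) ∈ Subgroup.center T := by
  obtain ⟨z, hz, h⟩ := exists_lift_eq ι hι (incl G b)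
  rw [h, incl_base]
  have := hι 1 1
  rw [mul_one, mul_inv_cancel_right] at this
  exact mul_mem hz this

end Lift

/-- The boundary `2`-chains → `1`-chains. -/
noncomputable def boundary (G : Type u) [Group G] : ChainQuot G →+ (G →₀ ULift.{u} ℤ) :=
  chainLift (fun g h => Finsupp.single h 1 - Finsupp.single (g * h) 1 + Finsupp.single g 1)
    fun g h k => by
      rw [mul_assoc]
      abel

theorem boundary_cocycle (g h : G) : boundary G (cocycle g h) =
    Finsupp.single h 1 - Finsupp.single (g * h) 1 + Finsupp.single g 1 :=
  chainLift_cocycle _ _ g h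

theorem boundary_mk (x : G × G →₀ ULift.{u} ℤ) :
    boundary G (QuotientAddGroup.mk x) = (d₂₁ (trivRep G)).hom x := by
  have h : (boundary G).comp (QuotientAddGroup.mk' _) =
      ((d₂₁ (trivRep G)).hom.toAddMonoidHom :
        (G × G →₀ ULift.{u} ℤ) →+ (G →₀ ULift.{u} ℤ)) := by
    apply ulift_finsupp_hom_ext
    rintro ⟨g, h⟩
    exact (boundary_cocycle g h).trans (d₂₁_trivRep_single g h 1).symm
  exact DFunLike.congr_fun h x

/-- The abelianization of the extension. -/
noncomputable def toChains (G : Type u) [Group G] :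
    UnivExt G →* Multiplicative (G →₀ ULift.{u} ℤ) :=
  MonoidHom.mk' (fun a => Multiplicative.ofAdd (boundary G a.coeff + Finsupp.single a.base 1))
    fun a b => by
      rw [mul_coeff, mul_base, map_add (boundary G), map_add (boundary G), boundary_cocycle,
        ← ofAdd_add]
      congr 1
      abel

theorem toChains_apply (a : UnivExt G) : toChains G a =
    Multiplicative.ofAdd (boundary G a.coeff + Finsupp.single a.base 1) := rfl

theorem toChains_incl (b : Multiplicative (ChainQuot G)) :
    toChains G (incl G b) = Multiplicative.ofAdd (boundary G b.toAdd) := by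
  change Multiplicative.ofAdd (boundary G (b.toAdd - cocycle 1 1) + Finsupp.single 1 1) = _
  rw [map_sub, boundary_cocycle]
  congr 1
  simp

/-- Sending the basis element g to the class of `sec g` defines β from 1-chains to the
abelianization. The relation `sec_mul_sec` says that β ∘ boundary is the class of `incl`, so β
recovers the class of a from `toChains G a`. -/
theorem mem_commutator_of_toChains_eq_one {a : UnivExt G} (h : toChains G a = 1) :
    a ∈ commutator (UnivExt G) := by
  obtain ⟨β, hβ⟩ : ∃ β : (G →₀ ULift.{u} ℤ) →+ Additive (Abelianization (UnivExt G)),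
      ∀ g, β (Finsupp.single g 1) = Additive.ofMul (Abelianization.of (sec g)) :=
    ⟨_, finsuppLift_single fun g => Additive.ofMul (Abelianization.of (sec g))⟩
  have key : MonoidHom.toAdditiveRight (Abelianization.of.comp (incl G)) =
      β.comp (boundary G) := by
    apply chainQuot_hom_ext
    intro x y
    have h1 := congrArg Abelianization.of (sec_mul_sec x y)
    rw [map_mul, map_mul, ← mul_inv_eq_iff_eq_mul] at h1
    change Additive.ofMul (Abelianization.of (incl G (Multiplicative.ofAdd (cocycle x y)))) =
      β (boundary G (cocycle x y))
    rw [boundary_cocycle, map_add, map_sub, hβ, hβ, hβ, ← h1, ofMul_mul, ofMul_inv, ofMul_mul]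
    abel
  have h3 : Additive.ofMul (Abelianization.of (incl G (Multiplicative.ofAdd a.coeff))) =
      β (boundary G a.coeff) := DFunLike.congr_fun key a.coeff
  have h4 : boundary G a.coeff + Finsupp.single a.base 1 = 0 := by
    rw [toChains_apply] at h
    exact Multiplicative.ofAdd.injective h
  have h2 : Additive.ofMul (Abelianization.of a) = 0 := by
    rw [eq_incl_mul_sec a, map_mul, ofMul_mul, h3, ← hβ, ← map_add, h4, map_zero]
  rw [← Abelianization.ker_of]
  exact Additive.ofMul.injective h2

end UnivExt

end ParamSymm

/-! ### The cokernel of μ_n and H₁ -/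

namespace ParamSymm

section Wreath

variable {n : ℕ} {E : Type*} [Group E]

/-- The homomorphism `(e, σ) ↦ ∏ f(e_k)` to a commutative group. -/
def wreathProd (n : ℕ) {E B : Type*} [Group E] [CommGroup B] (f : E →* B) :
    (Fin n → E) ⋊[mulAutArrow] Equiv.Perm (Fin n) →* B :=
  MonoidHom.mk' (fun w => ∏ k, f (w.left k)) fun v w => by
    rw [← Equiv.prod_comp v.right⁻¹ (fun k => f (w.left k)), ← Finset.prod_mul_distrib]
    refine Finset.prod_congr rfl fun k _ => ?_
    rw [← map_mul]
    rfl

variable {B : Type*} [CommGroup B]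

theorem wreathProd_apply (f : E →* B) (w : (Fin n → E) ⋊[mulAutArrow] Equiv.Perm (Fin n)) :
    wreathProd n f w = ∏ k, f (w.left k) := rfl

theorem wreathProd_inl_mulSingle (f : E →* B) (k : Fin n) (e : E) :
    wreathProd n f (SemidirectProduct.inl (Pi.mulSingle k e)) = f e := by
  rw [wreathProd_apply, Finset.prod_eq_single k]
  · simp
  · intro l _ hl
    simp [Pi.mulSingle_eq_of_ne hl]
  · simp

theorem wreathProd_inr (f : E →* B) (σ : Equiv.Perm (Fin n)) :
    wreathProd n f (SemidirectProduct.inr σ) = 1 := by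
  simp [wreathProd_apply]

theorem arrow_mulSingle (σ : Equiv.Perm (Fin n)) (k : Fin n) (e : E) :
    (mulAutArrow σ : MulAut (Fin n → E)) (Pi.mulSingle k e) = Pi.mulSingle (σ k) e := by
  ext l
  change (Pi.mulSingle k e : Fin n → E) (σ⁻¹ l) = _
  by_cases h : l = σ k
  · subst h
    simp
  · rw [Pi.mulSingle_eq_of_ne h, Pi.mulSingle_eq_of_ne]
    rintro rfl
    simp at h

theorem inr_mul_inl_mulSingle (σ : Equiv.Perm (Fin n)) (k : Fin n) (e : E) :
    (SemidirectProduct.inr σ * SemidirectProduct.inl (Pi.mulSingle k e) *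
      (SemidirectProduct.inr σ)⁻¹ : (Fin n → E) ⋊[mulAutArrow] Equiv.Perm (Fin n)) =
      SemidirectProduct.inl (Pi.mulSingle (σ k) e) := by
  rw [← arrow_mulSingle, SemidirectProduct.inl_aut, map_inv]

theorem mu_s_eq {n : ℕ} {E : Type u} [Group E] (i : Fin (n - 1)) (e : E) :
    mu n E (s i e) = SemidirectProduct.inl (Pi.mulSingle (lo i) e) *
      (SemidirectProduct.inl (Pi.mulSingle (hi i) e))⁻¹ *
        SemidirectProduct.inr (Equiv.swap (lo i) (hi i)) := by
  rw [mu_s, SemidirectProduct.mk_eq_inl_mul_inr, ← map_inv, ← map_mul, Pi.mulSingle_inv]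

theorem wreathProd_mu {n : ℕ} {E : Type u} [Group E] (f : E →* B) (m : SymG n E) :
    wreathProd n f (mu n E m) = 1 := by
  induction m using symG_induction with
  | one => simp
  | mul i a m ih =>
    rw [map_mul, map_mul, ih, mu_s_eq, map_mul, map_mul, map_inv, wreathProd_inl_mulSingle,
      wreathProd_inl_mulSingle, wreathProd_inr]
    simp

/-- The vectors (a, a⁻¹, 1) and (b, 1, b⁻¹) lie in the image and overlap only at the first place, so
their commutator is [a, b] there. This is where a third place is needed. -/
theorem inl_mulSingle_mem_range_mu {n : ℕ} {E : Type u} [Group E] (hn : 3 ≤ n) {e : E}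
    (he : e ∈ commutator E) :
    SemidirectProduct.inl (Pi.mulSingle (pa hn) e) ∈ (mu n E).range := by
  have h : commutator E ≤ (mu n E).range.comap (kappa hn E) := by
    rw [commutator_def, Subgroup.commutator_le]
    intro a _ b _
    refine ⟨liftAB hn a * liftAC hn b * (liftAB hn a)⁻¹ * (liftAC hn b)⁻¹, ?_⟩
    rw [map_mul, map_mul, map_mul, map_inv, map_inv, mu_liftAB, mu_liftAC, kappa_apply]
    simp only [← map_mul, ← map_inv]
    congr 1
    ext k
    by_cases ha : k = pa hn
    · subst ha
      simp [Pi.mulSingle_eq_of_ne (pa_ne_pb hn), Pi.mulSingle_eq_of_ne (pa_ne_pc hn),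
        commutatorElement_def]
    · by_cases hb : k = pb hn
      · subst hb
        simp [ha, Pi.mulSingle_eq_of_ne (pb_ne_pc hn)]
      · simp [ha, hb]
  exact h he

theorem range_mu_normal {n : ℕ} (hn : 3 ≤ n) (G : Type u) [Group G] : (mu n G).range.Normal where
  conj_mem := by
    rintro _ ⟨m, rfl⟩ w
    exact ⟨act hn G w m, mu_act hn w m⟩

/-- The cokernel of `mu` is the abelianization of `G`. -/
theorem nonempty_quotient_range_mu_equiv {n : ℕ} (hn : 3 ≤ n) (G : Type u) [Group G]
    [(mu n G).range.Normal] :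
    Nonempty ((Wreath n G ⧸ (mu n G).range) ≃* Abelianization G) := by
  let q := QuotientGroup.mk' (mu n G).range
  have hq : ∀ m, q (mu n G m) = 1 := fun m => (QuotientGroup.eq_one_iff _).2 ⟨m, rfl⟩
  let f : (Wreath n G ⧸ (mu n G).range) →* Abelianization G :=
    QuotientGroup.lift _ (wreathProd n Abelianization.of) (by
      rintro _ ⟨m, rfl⟩
      exact wreathProd_mu _ m)
  have hker : commutator G ≤ (q.comp (kappa hn G)).ker := fun e he => by
    obtain ⟨m, hm⟩ := inl_mulSingle_mem_range_mu hn he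
    rw [MonoidHom.mem_ker, MonoidHom.comp_apply, kappa_apply, ← hm]
    exact hq m
  let ψ : Abelianization G →* Wreath n G ⧸ (mu n G).range :=
    QuotientGroup.lift _ (q.comp (kappa hn G)) hker
  have hψ : ∀ x, ψ (Abelianization.of x) = q (kappa hn G x) := fun x => rfl
  have h1 : ψ.comp f = MonoidHom.id _ := by
    apply QuotientGroup.monoidHom_ext
    apply SemidirectProduct.hom_ext
    · apply MonoidHom.pi_ext
      intro k x
      change ψ (wreathProd n Abelianization.of (SemidirectProduct.inl (Pi.mulSingle k x))) =
        q (SemidirectProduct.inl (Pi.mulSingle k x))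
      -- A permutation carries the first place to place k, and permutations vanish in the quotient.
      have h2 := inr_mul_inl_mulSingle (Equiv.swap (pa hn) k) (pa hn) x
      rw [Equiv.swap_apply_left] at h2
      rw [wreathProd_inl_mulSingle, hψ, ← h2, map_mul, map_mul, map_inv, ← mu_hat, hq, one_mul,
        inv_one, mul_one, kappa_apply]
    · ext σ
      change ψ (wreathProd n Abelianization.of (SemidirectProduct.inr σ)) =
        q (SemidirectProduct.inr σ)
      rw [wreathProd_inr, map_one, ← mu_hat, hq]
  have h2 : f.comp ψ = MonoidHom.id _ := by
    apply Abelianization.hom_ext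
    ext x
    exact wreathProd_inl_mulSingle _ _ _
  exact ⟨MonoidHom.toMulEquiv f ψ h1 h2⟩

end Wreath

theorem nonempty_H_one_equiv (G : Type u) [Group G] :
    Nonempty (Abelianization G ≃* Multiplicative (H 1 G)) := by
  let e : Additive (Abelianization G) ≃+ H 1 G :=
    ((TensorProduct.rid ℤ (Additive (Abelianization G))).symm.toAddEquiv.trans
      (TensorProduct.congr (LinearEquiv.refl ℤ (Additive (Abelianization G)))
        (AddEquiv.ulift.{0, u} (α := ℤ)).symm.toIntLinearEquiv).toAddEquiv).trans
      (groupHomology.H1AddEquivOfIsTrivial (trivRep G)).symm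
  exact ⟨(AddEquiv.toMultiplicative e : Multiplicative (Additive (Abelianization G)) ≃* _)⟩

end ParamSymm

/-! ### Comparison of S_n(G) with E ≀ S_n modulo central vectors -/

namespace ParamSymm

open UnivExt

variable {n : ℕ} {G : Type u} [Group G]

/-- The vectors with central entries whose product is trivial. -/
noncomputable def centralZero (n : ℕ) (G : Type u) [Group G] : Subgroup (Wreath n (UnivExt G)) where
  carrier := {w | ∃ α : Fin n → Multiplicative (ChainQuot G), ∏ k, α k = 1 ∧
    w = SemidirectProduct.inl fun k => incl G (α k)}
  one_mem' := ⟨1, by simp, by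
    rw [← map_one SemidirectProduct.inl]
    congr 1
    ext1 k
    simp⟩
  mul_mem' := by
    rintro _ _ ⟨α, hα, rfl⟩ ⟨β, hβ, rfl⟩
    refine ⟨α * β, by simp [Finset.prod_mul_distrib, hα, hβ], ?_⟩
    rw [← map_mul]
    congr 1
    ext1 k
    simp
  inv_mem' := by
    rintro _ ⟨α, hα, rfl⟩
    refine ⟨α⁻¹, by simp [hα], ?_⟩
    rw [← map_inv]
    congr 1
    ext1 k
    simp

theorem mem_centralZero {w : Wreath n (UnivExt G)} : w ∈ centralZero n G ↔
    ∃ α : Fin n → Multiplicative (ChainQuot G), ∏ k, α k = 1 ∧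
      w = SemidirectProduct.inl fun k => incl G (α k) := Iff.rfl

instance : (centralZero n G).Normal where
  conj_mem := by
    rintro _ ⟨α, hα, rfl⟩ w
    refine ⟨fun k => α (w.right⁻¹ k), ?_, ?_⟩
    · rw [← hα]
      exact Equiv.prod_comp w.right⁻¹ α
    · have h : w * SemidirectProduct.inl (fun k => incl G (α k)) * w⁻¹ = SemidirectProduct.inl
          (w.left * mulAutArrow w.right (fun k => incl G (α k)) * w.left⁻¹) := by
        conv_lhs => rw [← SemidirectProduct.inl_left_mul_inr_right w]
        rw [map_mul, map_mul, SemidirectProduct.inl_aut, map_inv, map_inv]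
        group
      rw [h]
      congr 1
      ext1 k
      simp only [Pi.mul_apply, Pi.inv_apply, arrow_apply]
      rw [← incl_comm, mul_inv_cancel_right]

/-- The quotient of `E ≀ S_n`, for `E` the universal extension, by `centralZero`. -/
abbrev WreathQuot (n : ℕ) (G : Type u) [Group G] : Type u :=
  Wreath n (UnivExt G) ⧸ centralZero n G

/-- Multiplying e by a central b changes the vector by b at place i and b⁻¹ at place i + 1, whose
product is 1. This dictates the choice of `centralZero`. -/
theorem mk_mu_s_eq (i : Fin (n - 1)) {e e' : UnivExt G} (h : e.base = e'.base) :
    (mu n _ (s i e) : WreathQuot n G) = mu n _ (s i e') := by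
  have hne : lo i ≠ hi i := by simp [lo, hi]
  obtain ⟨b, hb⟩ : ∃ b, incl G b = e * e'⁻¹ := exists_incl (by
    rw [mul_base, inv_base, h, mul_inv_cancel])
  obtain rfl : e = incl G b * e' := by rw [hb, inv_mul_cancel_right]
  rw [QuotientGroup.eq_iff_div_mem, mu_s, mu_s, SemidirectProduct.mk_eq_inl_mul_inr,
    SemidirectProduct.mk_eq_inl_mul_inr, mul_div_mul_right_eq_div, ← map_div]
  refine ⟨Pi.mulSingle (lo i) b * Pi.mulSingle (hi i) b⁻¹, ?_, ?_⟩
  · simp only [Pi.mul_apply, Finset.prod_mul_distrib, Finset.prod_pi_mulSingle']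
    simp
  · congr 1
    ext1 k
    simp only [Pi.mul_apply, Pi.div_apply]
    by_cases hl : k = lo i
    · subst hl
      simp [Pi.mulSingle_eq_of_ne hne]
    · by_cases hh : k = hi i
      · subst hh
        simp [hl, incl_comm]
      · simp [hl, hh]

theorem embedGen_rel (r : FreeGroup (Fin (n - 1) × G))
    (hr : r ∈ {r : FreeGroup (Fin (n - 1) × G) | Rel n G r}) :
    FreeGroup.lift (fun x : Fin (n - 1) × G =>
      (mu n _ (s x.1 (sec x.2)) : WreathQuot n G)) r = 1 := by
  rcases hr with ⟨i, a⟩ | ⟨i, j, hij, a, b, c⟩ | ⟨i, j, hij, a, b⟩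
  · rw [map_pow, FreeGroup.lift_apply_of, pow_two, ← QuotientGroup.mk_mul, ← map_mul, s_sq,
      map_one]
    rfl
  · rw [map_mul, map_inv, mul_inv_eq_one]
    simp only [map_mul, FreeGroup.lift_apply_of]
    -- The section is not multiplicative, but only the image in G counts modulo `centralZero`.
    rw [mk_mu_s_eq j (e := sec (a⁻¹ * c * b)) (e' := (sec a)⁻¹ * sec c * sec b) rfl]
    simp only [← QuotientGroup.mk_mul, ← map_mul]
    rw [s_braid i j hij]
  · rw [map_mul, map_inv, mul_inv_eq_one]
    simp only [map_mul, FreeGroup.lift_apply_of]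
    simp only [← QuotientGroup.mk_mul, ← map_mul]
    rw [s_comm i j hij]

/-- The homomorphism from `S_n(G)` to the quotient of `E ≀ S_n`. -/
noncomputable def embed (n : ℕ) (G : Type u) [Group G] : SymG n G →* WreathQuot n G :=
  PresentedGroup.toGroup embedGen_rel

theorem embed_s (i : Fin (n - 1)) (a : G) : embed n G (s i a) = mu n _ (s i (sec a)) :=
  PresentedGroup.toGroup.of embedGen_rel

theorem baseGen_rel (r : FreeGroup (Fin (n - 1) × UnivExt G))
    (hr : r ∈ {r : FreeGroup (Fin (n - 1) × UnivExt G) | Rel n (UnivExt G) r}) :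
    FreeGroup.lift (fun x : Fin (n - 1) × UnivExt G => s x.1 (proj G x.2)) r = 1 := by
  rcases hr with ⟨i, a⟩ | ⟨i, j, hij, a, b, c⟩ | ⟨i, j, hij, a, b⟩
  · rw [map_pow, FreeGroup.lift_apply_of, pow_two, s_sq]
  · rw [map_mul, map_inv, mul_inv_eq_one]
    simp only [map_mul, FreeGroup.lift_apply_of, map_inv]
    rw [s_braid i j hij]
  · rw [map_mul, map_inv, mul_inv_eq_one]
    simp only [map_mul, FreeGroup.lift_apply_of]
    rw [s_comm i j hij]

/-- The homomorphism `S_n(E) → S_n(G)` induced by the projection. -/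
noncomputable def symProj (n : ℕ) (G : Type u) [Group G] : SymG n (UnivExt G) →* SymG n G :=
  PresentedGroup.toGroup baseGen_rel

theorem symProj_s (i : Fin (n - 1)) (a : UnivExt G) : symProj n G (s i a) = s i a.base :=
  PresentedGroup.toGroup.of baseGen_rel

theorem embed_symProj (m : SymG n (UnivExt G)) :
    embed n G (symProj n G m) = (mu n _ m : WreathQuot n G) := by
  have h : (embed n G).comp (symProj n G) =
      (QuotientGroup.mk' (centralZero n G)).comp (mu n (UnivExt G)) := by
    apply symG_hom_ext
    intro i e
    change embed n G (symProj n G (s i e)) = (mu n _ (s i e) : WreathQuot n G)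
    rw [symProj_s, embed_s]
    exact mk_mu_s_eq i rfl
  exact DFunLike.congr_fun h m

/-- The projection to `G ≀ S_n`. -/
noncomputable def quotProj (n : ℕ) (G : Type u) [Group G] : WreathQuot n G →* Wreath n G :=
  QuotientGroup.lift _
    (SemidirectProduct.map ((proj G).compLeft (Fin n)) (MonoidHom.id _) fun _ => by
      ext; rfl) (by
      rintro _ ⟨α, -, rfl⟩
      rfl)

theorem quotProj_mk (w : Wreath n (UnivExt G)) :
    quotProj n G w = ⟨fun k => (w.left k).base, w.right⟩ := rfl

theorem quotProj_embed (m : SymG n G) : quotProj n G (embed n G m) = mu n G m := by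
  have h : (quotProj n G).comp (embed n G) = mu n G := by
    apply symG_hom_ext
    intro i a
    change quotProj n G (embed n G (s i a)) = _
    rw [embed_s, quotProj_mk, mu_s, mu_s]
    ext1
    · ext1 k
      simp only [Pi.mul_apply]
      rw [← proj_apply, map_mul, Pi.mulSingle_apply, Pi.mulSingle_apply, Pi.mulSingle_apply,
        Pi.mulSingle_apply, apply_ite (proj G), apply_ite (proj G), map_one, map_inv]
      rfl
    · rfl
  exact DFunLike.congr_fun h m

/-- The inclusion of the kernel of `quotProj`. -/
noncomputable def kerIncl (hn : 3 ≤ n) (G : Type u) [Group G] :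
    Multiplicative (ChainQuot G) →* WreathQuot n G :=
  (QuotientGroup.mk' (centralZero n G)).comp ((kappa hn (UnivExt G)).comp (incl G))

theorem kerIncl_apply (hn : 3 ≤ n) (b : Multiplicative (ChainQuot G)) : kerIncl hn G b =
    (SemidirectProduct.inl (Pi.mulSingle (pa hn) (incl G b)) : Wreath n (UnivExt G)) := rfl

theorem kerIncl_injective (hn : 3 ≤ n) : Function.Injective (kerIncl hn G) := by
  rw [injective_iff_map_eq_one]
  intro b hb
  rw [kerIncl_apply, QuotientGroup.eq_one_iff, mem_centralZero] at hb
  obtain ⟨α, h1, h2⟩ := hb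
  have h3 := congrFun (SemidirectProduct.inl_injective h2)
  rw [Finset.prod_eq_single (pa hn)] at h1
  · have h4 := h3 (pa hn)
    rw [Pi.mulSingle_eq_same, h1] at h4
    exact incl_injective h4
  · intro k _ hk
    have h4 := h3 k
    rw [Pi.mulSingle_eq_of_ne hk, ← map_one (incl G)] at h4
    exact (incl_injective h4).symm
  · simp

/-- Modulo `centralZero`, a vector with entries in the kernel can be concentrated at the first place
by multiplying its entries together. -/
theorem exists_kerIncl (hn : 3 ≤ n) {x : WreathQuot n G} (hx : quotProj n G x = 1) :
    ∃ b, kerIncl hn G b = x := by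
  obtain ⟨w, rfl⟩ := QuotientGroup.mk_surjective x
  rw [quotProj_mk] at hx
  have h1 : w.right = 1 := congrArg SemidirectProduct.right hx
  have h2 : ∀ k, (w.left k).base = 1 := congrFun (congrArg SemidirectProduct.left hx)
  choose α hα using fun k => exists_incl (h2 k)
  refine ⟨∏ k, α k, ?_⟩
  have hw : w = SemidirectProduct.inl fun k => incl G (α k) := by
    ext1
    · ext1 k
      exact (hα k).symm
    · exact h1
  rw [kerIncl_apply, QuotientGroup.eq_iff_div_mem, hw, ← map_div]
  refine ⟨Pi.mulSingle (pa hn) (∏ k, α k) / α, ?_, ?_⟩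
  · simp [Finset.prod_div_distrib]
  · congr 1
    ext1 k
    rw [Pi.div_apply, Pi.div_apply, map_div, Pi.mulSingle_apply, Pi.mulSingle_apply,
      apply_ite (incl G), map_one]

/-- The total boundary. -/
noncomputable def quotChains (n : ℕ) (G : Type u) [Group G] :
    WreathQuot n G →* Multiplicative (G →₀ ULift.{u} ℤ) :=
  QuotientGroup.lift _ (wreathProd n (toChains G)) (by
    rintro _ ⟨α, h, rfl⟩
    change ∏ k, toChains G (incl G (α k)) = 1
    rw [← map_one ((toChains G).comp (incl G)), ← h, map_prod]
    rfl)

theorem quotChains_embed (m : SymG n G) : quotChains n G (embed n G m) = 1 := by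
  have h : (quotChains n G).comp (embed n G) = 1 := by
    apply symG_hom_ext
    intro i a
    change quotChains n G (embed n G (s i a)) = _
    rw [embed_s]
    exact wreathProd_mu _ _
  exact DFunLike.congr_fun h m

theorem quotChains_kerIncl (hn : 3 ≤ n) (b : Multiplicative (ChainQuot G)) :
    quotChains n G (kerIncl hn G b) = Multiplicative.ofAdd (boundary G b.toAdd) :=
  (wreathProd_inl_mulSingle _ _ _).trans (toChains_incl b)

/-- A cycle lies in the commutator subgroup of the extension, so at the first place it comes from
S_n of the extension; its projection to S_n(G) is the required element. -/
theorem exists_embed_eq_kerIncl (hn : 3 ≤ n) {b : Multiplicative (ChainQuot G)}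
    (hb : boundary G b.toAdd = 0) : ∃ m, embed n G m = kerIncl hn G b := by
  obtain ⟨m, hm⟩ := inl_mulSingle_mem_range_mu hn (mem_commutator_of_toChains_eq_one (a := incl G b)
    (by rw [toChains_incl, hb, ofAdd_zero]))
  exact ⟨symProj n G m, by rw [embed_symProj, hm, kerIncl_apply]⟩

end ParamSymm

/-! ### Injectivity of the comparison map, and the kernel as H₂ -/

namespace ParamSymm

open UnivExt groupHomology

variable {n : ℕ} {G : Type u} [Group G]

/-- The injection j into the group T of `exists_lift` factors through `embed`: the lifts ι extend to
E by its universal property, their conjugates under S_n give commuting copies of E, and these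
assemble to a homomorphism from E ≀ S_n. -/
theorem embed_injective (hn : 3 ≤ n) : Function.Injective (embed n G) := by
  obtain ⟨T, _, j, ι, hj, hι, hact, hcomm⟩ := (commutatorPairing hn G).exists_lift
  let L : UnivExt G →* T := UnivExt.lift ι hι
  let jh : Equiv.Perm (Fin n) →* T := j.comp (hat n G)
  have hL : ∀ e, ∃ z ∈ Subgroup.center T, L e = z * ι e.base := exists_lift_eq ι hι
  have hfix : ∀ (ρ : Equiv.Perm (Fin n)), ρ (pa hn) = pa hn → ∀ e, Commute (jh ρ) (L e) := by
    intro ρ hρ e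
    obtain ⟨z, hz, he⟩ := hL e
    rw [he]
    refine Commute.mul_right (Subgroup.mem_center_iff.1 hz _) ?_
    have h := hact e.base (hat n G ρ)
    rw [act_kappa_hat hn _ hρ, mul_inv_eq_iff_eq_mul] at h
    exact h.symm
  have hconj : ∀ (σ τ : Equiv.Perm (Fin n)), σ (pa hn) = τ (pa hn) → ∀ e,
      jh σ * L e * (jh σ)⁻¹ = jh τ * L e * (jh τ)⁻¹ := by
    intro σ τ h e
    have h1 := hfix (τ⁻¹ * σ) (by simp [h]) e
    have h2 : jh σ = jh τ * jh (τ⁻¹ * σ) := by rw [← map_mul, mul_inv_cancel_left]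
    rw [h2, mul_inv_rev, mul_assoc (jh τ), h1.eq]
    group
  have hcommL : ∀ (σ : Equiv.Perm (Fin n)), σ (pa hn) ≠ pa hn → ∀ e e',
      Commute (jh σ * L e * (jh σ)⁻¹) (L e') := by
    intro σ hσ e e'
    obtain ⟨z, hz, he⟩ := hL e
    obtain ⟨z', hz', he'⟩ := hL e'
    rw [he, he']
    refine Commute.mul_right (Subgroup.mem_center_iff.1 hz' _) ?_
    have h1 : jh σ * (z * ι e.base) * (jh σ)⁻¹ = z * (jh σ * ι e.base * (jh σ)⁻¹) := by
      rw [← mul_assoc, Subgroup.mem_center_iff.1 hz (jh σ)]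
      group
    rw [h1]
    refine Commute.mul_left (Subgroup.mem_center_iff.1 hz _).symm ?_
    -- The conjugate stands at a place other than the first, so the pairing reduces to `lam` at 1.
    refine hcomm (hat n G σ) e.base e'.base ?_
    rw [mu_hat, kappa_apply, inr_mul_inl_mulSingle, pairing_inl, Pi.mulSingle_eq_of_ne hσ.symm,
      lam_one]
  let φ : Fin n → UnivExt G →* T := fun k =>
    (MulAut.conj (jh (Equiv.swap (pa hn) k))).toMonoidHom.comp L
  have hφ : ∀ (σ : Equiv.Perm (Fin n)) e, φ (σ (pa hn)) e = jh σ * L e * (jh σ)⁻¹ := fun σ e =>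
    hconj _ _ (Equiv.swap_apply_left _ _) e
  have hφ' : ∀ (σ : Equiv.Perm (Fin n)) k e, φ (σ k) e = jh σ * φ k e * (jh σ)⁻¹ := by
    intro σ k e
    have h1 := hφ (Equiv.swap (pa hn) k) e
    have h2 := hφ (σ * Equiv.swap (pa hn) k) e
    rw [Equiv.swap_apply_left] at h1
    rw [Equiv.Perm.mul_apply, Equiv.swap_apply_left] at h2
    rw [h1, h2, map_mul, mul_inv_rev]
    simp only [mul_assoc]
  -- Conjugating by the swap of l with the first place reduces to `hcommL`.
  have hpw : Pairwise fun k l => ∀ x y, Commute (φ k x) (φ l y) := by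
    intro k l hkl x y
    have h1 := hφ' (Equiv.swap (pa hn) l) (Equiv.swap (pa hn) l k) x
    have h2 := hφ' (Equiv.swap (pa hn) l) (pa hn) y
    have h3 := hφ 1 y
    rw [Equiv.swap_apply_self] at h1
    rw [Equiv.swap_apply_left] at h2
    rw [Equiv.Perm.one_apply, map_one, one_mul, inv_one, mul_one] at h3
    rw [h1, h2, h3]
    have h4 : Equiv.swap (pa hn) l k ≠ pa hn := by
      intro h
      apply hkl
      have h' := congrArg (Equiv.swap (pa hn) l) h
      rwa [Equiv.swap_apply_self, Equiv.swap_apply_left] at h'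
    have h5 := hφ (Equiv.swap (pa hn) (Equiv.swap (pa hn) l k)) x
    rw [Equiv.swap_apply_left] at h5
    rw [h5]
    refine Commute.map (hcommL _ ?_ x y) (MulAut.conj (jh (Equiv.swap (pa hn) l)))
    rwa [Equiv.swap_apply_left]
  let Φ : (Fin n → UnivExt G) →* T := MonoidHom.noncommPiCoprod φ hpw
  have hΦ : ∀ k e, Φ (Pi.mulSingle k e) = φ k e := fun k e =>
    MonoidHom.noncommPiCoprod_mulSingle (ϕ := φ) (hcomm := hpw) k e
  let Ψ : Wreath n (UnivExt G) →* T := SemidirectProduct.lift Φ jh fun σ => by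
    apply MonoidHom.pi_ext
    intro k e
    change Φ (mulAutArrow σ (Pi.mulSingle k e)) = jh σ * Φ (Pi.mulSingle k e) * (jh σ)⁻¹
    rw [arrow_mulSingle, hΦ, hΦ, hφ']
  have hcen : ∀ k b, φ k (incl G b) = L (incl G b) := by
    intro k b
    have h := Subgroup.mem_center_iff.1 (lift_incl_mem_center ι hι b)
      (jh (Equiv.swap (pa hn) k))
    change jh (Equiv.swap (pa hn) k) * L (incl G b) * (jh (Equiv.swap (pa hn) k))⁻¹ = _
    rw [mul_inv_eq_iff_eq_mul]
    exact h
  -- On central entries all φ k agree with L, so Ψ sees only the product of the entries.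
  have hkill : centralZero n G ≤ Ψ.ker := by
    rintro _ ⟨α, h, rfl⟩
    rw [MonoidHom.mem_ker, SemidirectProduct.lift_inl]
    have h1 : (fun k => incl G (α k)) = (incl G).compLeft (Fin n) α := rfl
    have h2 : Φ.comp ((incl G).compLeft (Fin n)) =
        (L.comp (incl G)).comp (wreathProd n (MonoidHom.id _) |>.comp SemidirectProduct.inl) := by
      apply MonoidHom.pi_ext
      intro k b
      have h3 : (incl G).compLeft (Fin n) (Pi.mulSingle k b) = Pi.mulSingle k (incl G b) := by
        ext1 l
        change incl G ((Pi.mulSingle k b : Fin n → Multiplicative (ChainQuot G)) l) = _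
        rw [Pi.mulSingle_apply, Pi.mulSingle_apply, apply_ite (incl G), map_one]
      rw [MonoidHom.comp_apply, h3, hΦ, hcen, MonoidHom.comp_apply, MonoidHom.comp_apply,
        MonoidHom.comp_apply, wreathProd_inl_mulSingle]
      rfl
    rw [h1, ← MonoidHom.comp_apply, h2, MonoidHom.comp_apply, MonoidHom.comp_apply,
      MonoidHom.comp_apply, wreathProd_apply]
    change L (incl G (∏ k, α k)) = 1
    rw [h, map_one, map_one]
  let Q : WreathQuot n G →* T := QuotientGroup.lift _ Ψ hkill
  -- With φ = φ (lo i) (sec a) and s = j (s i 1), the image of s_i(a) is φ (s φ s⁻¹)⁻¹ s = φ s φ⁻¹,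
  -- and φ acts on the image of j as a at place i does.
  have hQ : Q.comp (embed n G) = j := by
    apply symG_hom_ext
    intro i a
    have hτ := hφ' (Equiv.swap (lo i) (hi i)) (lo i) (sec a)
    rw [Equiv.swap_apply_left] at hτ
    have h1 : Q (embed n G (s i a)) =
        φ (lo i) (sec a) * (φ (hi i) (sec a))⁻¹ * jh (Equiv.swap (lo i) (hi i)) := by
      rw [embed_s, mu_s_eq]
      change Ψ _ = _
      rw [map_mul, map_mul, map_inv, SemidirectProduct.lift_inl, SemidirectProduct.lift_inl,
        SemidirectProduct.lift_inr, hΦ, hΦ]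
    have h2 : ∀ m, φ (lo i) (sec a) * j m * (φ (lo i) (sec a))⁻¹ =
        j (diagAct n G (Pi.mulSingle (lo i) a) m) := by
      intro m
      have h3 := hφ (Equiv.swap (pa hn) (lo i)) (sec a)
      rw [Equiv.swap_apply_left] at h3
      have h4 : L (sec a) = ι a := lift_sec ι hι a
      have h5 := inr_mul_inl_mulSingle (Equiv.swap (pa hn) (lo i)) (pa hn) a
      rw [Equiv.swap_apply_left] at h5
      have h6 := act_inl hn (Pi.mulSingle (lo i) a) m
      rw [← h5, map_mul, map_mul, MulAut.mul_apply, MulAut.mul_apply, act_inr, ← map_inv,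
        act_inr, ← kappa_apply] at h6
      rw [h3, h4, ← h6, map_mul, map_mul, ← hact, map_inv (hat n G), inv_inv]
      simp only [map_mul, map_inv, mul_inv_rev, inv_inv, mul_assoc]
      rfl
    change Q (embed n G (s i a)) = _
    have hne : hi i ≠ lo i := by simp [lo, hi]
    have h7 : jh (Equiv.swap (lo i) (hi i)) = j (s i 1) := by
      change j (hat n G _) = _
      rw [hat_swap]
    rw [h1, hτ, h7]
    have h8 := h2 (s i 1)
    rw [diagAct_s, Pi.mulSingle_eq_same, Pi.mulSingle_eq_of_ne hne, mul_one, inv_one,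
      mul_one] at h8
    rw [← h8]
    have h9 : j (s i 1) * j (s i 1) = 1 := by rw [← map_mul, s_sq, map_one]
    have h10 : (j (s i (1 : G)))⁻¹ = j (s i 1) := inv_eq_of_mul_eq_one_left h9
    simp only [mul_inv_rev, mul_assoc, h10, h9, mul_one]
  have : Function.Injective (Q.comp (embed n G)) := by rw [hQ]; exact hj
  exact Function.Injective.of_comp this

/-- An injective homomorphism and a homomorphism with the same image identify the source of the
first with any quotient of the source of the second that has the right kernel. -/
noncomputable def equivOfRangeEq {M N Q K : Type*} [Group M] [Group N] [Group Q] [Group K]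
    (f : M →* Q) (hf : Function.Injective f) (θ : N →* Q) (π : N →* K)
    (hπ : Function.Surjective π) (hr : f.range = θ.range) (hk : θ.ker = π.ker) : M ≃* K :=
  (MonoidHom.ofInjective hf).trans <| (MulEquiv.subgroupCongr hr).trans <|
    (QuotientGroup.quotientKerEquivRange θ).symm.trans <|
      (QuotientGroup.quotientMulEquivOfEq hk).trans <|
        QuotientGroup.quotientKerEquivOfSurjective π hπ

/-- Inside the copy of C₂/B₂ that is the kernel of `quotProj`, the image of ker μ_n is exactly
Z₂/B₂. -/
theorem nonempty_ker_mu_equiv (hn : 3 ≤ n) :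
    Nonempty ((mu n G).ker ≃* Multiplicative (H 2 G)) := by
  let i : cycles₂ (trivRep G) →+ ChainQuot G :=
    (QuotientAddGroup.mk' (boundaries₂ (trivRep G)).toAddSubgroup).comp
      (cycles₂ (trivRep G)).subtype.toAddMonoidHom
  let π : cycles₂ (trivRep G) →+ H 2 G := (H2π (trivRep G)).hom.toAddMonoidHom
  have hi : ∀ x, i x = QuotientAddGroup.mk x.1 := fun _ => rfl
  have hπ : Function.Surjective π := fun y => by
    induction y using H2_induction_on with
    | _ x => exact ⟨x, rfl⟩
  have hπ' : ∀ x, π x = 0 ↔ i x = 0 := fun x => by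
    rw [hi, QuotientAddGroup.eq_zero_iff]
    exact H2π_eq_zero_iff x
  have hz : ∀ x : cycles₂ (trivRep G), boundary G (i x) = 0 := fun x => by
    rw [hi, boundary_mk]
    exact x.2
  refine ⟨equivOfRangeEq ((embed n G).comp (mu n G).ker.subtype)
    ((embed_injective hn).comp Subtype.val_injective)
    ((kerIncl hn G).comp (AddMonoidHom.toMultiplicative i)) (AddMonoidHom.toMultiplicative π)
    (fun y => hπ y) ?_ ?_⟩
  · apply le_antisymm
    -- The total boundary `quotChains` is trivial on the image of `embed`, so the chain representing
    -- m is a cycle.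
    · rintro _ ⟨⟨m, hm⟩, rfl⟩
      obtain ⟨b, hb⟩ := exists_kerIncl hn (x := embed n G m) (by rw [quotProj_embed]; exact hm)
      have h1 := quotChains_kerIncl hn b
      rw [hb, quotChains_embed] at h1
      obtain ⟨x, hx⟩ := QuotientAddGroup.mk_surjective b.toAdd
      rw [← hx, boundary_mk] at h1
      have h2 : x ∈ cycles₂ (trivRep G) := (Multiplicative.ofAdd.injective h1).symm
      refine ⟨Multiplicative.ofAdd ⟨x, h2⟩, ?_⟩
      change kerIncl hn G (Multiplicative.ofAdd (QuotientAddGroup.mk x)) = embed n G m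
      rw [hx, ofAdd_toAdd, hb]
    · rintro _ ⟨x, rfl⟩
      obtain ⟨m, hm⟩ := exists_embed_eq_kerIncl hn
        (b := Multiplicative.ofAdd (i x.toAdd)) (hz x.toAdd)
      refine ⟨⟨m, ?_⟩, hm⟩
      rw [MonoidHom.mem_ker, ← quotProj_embed, hm, kerIncl_apply, quotProj_mk]
      ext1
      · ext1 k
        simp only [SemidirectProduct.left_inl]
        rw [← proj_apply, Pi.mulSingle_apply, apply_ite (proj G), map_one, proj_apply, incl_base,
          ite_self]
        rfl
      · rfl
  · ext x
    rw [MonoidHom.mem_ker, MonoidHom.mem_ker, MonoidHom.comp_apply,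
      map_eq_one_iff _ (kerIncl_injective hn)]
    exact (hπ' x.toAdd).symm

end ParamSymm

theorem theorem1 {G : Type u} [Group G] (n : ℕ) (hn : 3 ≤ n) :
    (∃ act : (ParamSymm.Wreath n G)ᵐᵒᵖ →* MulAut (ParamSymm.SymG n G),
      ParamSymm.IsCrossedModule (ParamSymm.mu n G) act ∧
      ∀ (h : Fin n → G) (i : Fin (n - 1)) (a : G),
        act (MulOpposite.op (SemidirectProduct.inl h)) (ParamSymm.s i a) =
          ParamSymm.s i ((h (ParamSymm.lo i))⁻¹ * a * h (ParamSymm.hi i))) ∧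
    (∃ _ : (ParamSymm.mu n G).range.Normal,
      Nonempty ((ParamSymm.Wreath n G ⧸ (ParamSymm.mu n G).range) ≃*
        Multiplicative (ParamSymm.H 1 G))) ∧
    Nonempty ((ParamSymm.mu n G).ker ≃* Multiplicative (ParamSymm.H 2 G)) := by
  -- The right action of x is the left action of x⁻¹.
  refine ⟨⟨(ParamSymm.act hn G).comp (MulEquiv.inv' (ParamSymm.Wreath n G)).symm.toMonoidHom,
    ⟨?_, ?_⟩, ?_⟩, ⟨ParamSymm.range_mu_normal hn G, ?_⟩, ParamSymm.nonempty_ker_mu_equiv hn⟩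
  · intro m w
    change ParamSymm.mu n G (ParamSymm.act hn G w⁻¹ m) = _
    rw [ParamSymm.mu_act, inv_inv]
  · intro m m'
    change ParamSymm.act hn G (ParamSymm.mu n G m')⁻¹ m = _
    rw [← map_inv, ParamSymm.act_mu, inv_inv]
  · intro h i a
    change ParamSymm.act hn G (SemidirectProduct.inl h)⁻¹ (ParamSymm.s i a) = _
    rw [← map_inv, ParamSymm.act_inl, ParamSymm.diagAct_s, Pi.inv_apply, Pi.inv_apply, inv_inv]
  · have := ParamSymm.range_mu_normal hn G
    obtain ⟨e⟩ := ParamSymm.nonempty_quotient_range_mu_equiv hn G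
    obtain ⟨e'⟩ := ParamSymm.nonempty_H_one_equiv G
    exact ⟨e.trans e'⟩
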